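/- There exist absolute constants $x_0, C_1, C_2 > 0$ such that the following holds for every real $x \ge x_0$. Let $\mathcal P_0$ be a set of primes, and suppose there is a real $c$ with $x^{-1/10} < c \le 1$ such that $$\sum_{\substack{y/2 < p \le y\\ p \in \mathcal P_0}} \log p \;\ge\; c \sum_{y/2 < p \le y} \log p \qquad \text{for all real } y \text{ with } x^{1/10} \le y \le x^{1/2},$$ where $p$ denotes primes throughout. Let $\mathcal S \subseteq [1,x]$ be a non-empty set of integers, none of which is divisible by any $p \in \mathcal P_0$, and let $\mathcal S_0 \subseteq \mathcal S$ be non-empty. Put $$\sigma := \frac{\#\mathcal S}{x}, \qquad \sigma_0 := \frac{\#\mathcal S_0}{\#\mathcal S}, \qquad K := \frac{1000 \log^2 x}{\sigma_0 \sigma c^2}, \qquad \mathcal P_0^* := \mathcal P_0 \cap [K^3, \infty).$$ Suppose that at least one of the following two conditions holds. 1. (Sieve Controls Size) $$\sum_{\substack{1 < q \le \sqrt x\\ p \mid q \Rightarrow p \in \mathcal P_0^*}} \mu^2(q) \prod_{p \mid q} \frac{2}{p} \;\ge\; \frac{10}{\sigma_0 \sigma}.$$ 2. (Bombieri--Vinogradov)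 There is a positive integer $Q$ such that $$\sum_{\substack{1 < q \le Q\\ p \mid q \Rightarrow p \in \mathcal P_0^*}} \frac{\mu^2(q)}{q} \;\ge\; \frac{10}{\sigma_0}$$ and $$\sum_{\substack{1 \le d \le Q^2\\ p \mid d \Rightarrow p \in \mathcal P_0^*}} \mu^2(d)\, \tau_3(d)^{1 + \frac{\log K}{\log 3}} \max_{(a,d)=1} \left| \#\{s \in \mathcal S : s \equiv a \bmod d\} - \frac{\#\mathcal S}{\phi(d)} \right| \;\le\; \frac{\sigma_0\, \#\mathcal S}{2K}.$$ Here $\mu$ is the Möbius function, $\phi$ is Euler's totient function, and $\tau_3(d)$ is the number of triples $(u,v,w)$ of positive integers with $uvw = d$. Then, whenever $\mathcal S_0 = \mathcal A + \mathcal B := \{a + b : a \in \mathcal A,\, b \in \mathcal B\}$ for sets $\mathcal A, \mathcal B$ of non-negative integers with $2 \le \#\mathcal A \le \#\mathcal B$, one has $$\#\mathcal B \le C_1\, \frac{\sqrt x\, \log^4 x}{c^4} \qquad\text{and}\qquad \#\mathcal A \ge C_2\, \frac{\sqrt x\, \sigma_0 \sigma\, c^4}{\log^4 x}.$$ -/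

import Mathlib

open scoped Pointwise

noncomputable section

namespace AdditiveDecomposition

open Classical in
/-- The sum of `log p` over the primes `p ∈ P` with `y / 2 < p ≤ y` (used for `y ≥ 0`). -/
def dyadicLogSum (P : Set ℕ) (y : ℝ) : ℝ :=
  ∑ p ∈ (Finset.Ioc ⌊y / 2⌋₊ ⌊y⌋₊).filter (fun p => p.Prime ∧ p ∈ P), Real.log p

/-- The density `σ = #S / x` of a finite set `S ⊆ [1, x]`. -/
def density (x : ℝ) (S : Finset ℕ) : ℝ := (S.card : ℝ) / x

/-- The relative density `σ₀ = #S₀ / #S` of `S₀` in `S`. -/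
def relDensity (S S₀ : Finset ℕ) : ℝ := (S₀.card : ℝ) / (S.card : ℝ)

/-- The parameter `K = 1000 (σ₀ σ c²)⁻¹ log² x`. -/
def paramK (x c : ℝ) (S S₀ : Finset ℕ) : ℝ :=
  1000 * (relDensity S S₀ * density x S * c ^ 2)⁻¹ * Real.log x ^ 2

/-- The set `P₀* = P₀ ∩ [K³, ∞)`. -/
def largePrimes (P₀ : Set ℕ) (K : ℝ) : Set ℕ := {p | p ∈ P₀ ∧ K ^ 3 ≤ (p : ℝ)}

/-- All prime divisors of `q` lie in `P`. -/
def PrimeDivisorsIn (P : Set ℕ) (q : ℕ) : Prop := ∀ p : ℕ, p.Prime → p ∣ q → p ∈ P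

/-- `τ₃(d)`, the number of triples of positive integers with product `d` (used for `d ≥ 1`). -/
def tau3 (d : ℕ) : ℕ := (Nat.finMulAntidiag 3 d).card

open Classical in
/-- The maximum over the reduced residue classes `a` modulo `d` of
`|#{s ∈ S : s ≡ a mod d} - #S / φ(d)|` (used for `d ≥ 1`, where the index set is finite
and non-empty). -/
def maxDiscrepancy (S : Finset ℕ) (d : ℕ) : ℝ :=
  ⨆ a : (ZMod d)ˣ,
    |((S.filter (fun s : ℕ => (s : ZMod d) = (a : ZMod d))).card : ℝ)
      - (S.card : ℝ) / (d.totient : ℝ)|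

open Classical in
/-- The "Sieve Controls Size" condition, for the set `P` of sieving primes
(to be taken as `P₀*`). -/
def SieveControlsSize (x : ℝ) (P : Set ℕ) (S S₀ : Finset ℕ) : Prop :=
  10 * (relDensity S S₀ * density x S)⁻¹ ≤
    ∑ q ∈ (Finset.Ioc 1 ⌊Real.sqrt x⌋₊).filter (fun q => PrimeDivisorsIn P q),
      (ArithmeticFunction.moebius q : ℝ) ^ 2 * ∏ p ∈ q.primeFactors, (2 : ℝ) / (p : ℝ)

open Classical in
/-- The "Bombieri–Vinogradov" condition, for the set `P` of sieving primes
(to be taken as `P₀*`). -/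
def BombieriVinogradov (K : ℝ) (P : Set ℕ) (S S₀ : Finset ℕ) : Prop :=
  ∃ Q : ℕ, 0 < Q ∧
    10 * (relDensity S S₀)⁻¹ ≤
      ∑ q ∈ (Finset.Ioc 1 Q).filter (fun q => PrimeDivisorsIn P q),
        (ArithmeticFunction.moebius q : ℝ) ^ 2 / (q : ℝ) ∧
    ∑ d ∈ (Finset.Icc 1 (Q ^ 2)).filter (fun d => PrimeDivisorsIn P d),
        (ArithmeticFunction.moebius d : ℝ) ^ 2 *
          (tau3 d : ℝ) ^ (1 + Real.log K / Real.log 3) * maxDiscrepancy S d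
      ≤ (S.card : ℝ) / (2 * K * (relDensity S S₀)⁻¹)

end AdditiveDecomposition

end

open AdditiveDecomposition

namespace AdditiveDecomposition

/-- The additive character `t ↦ exp (2 π i t)`. -/
noncomputable def expTwoPi (t : ℝ) : ℂ := Complex.exp (Complex.I * ((2 * Real.pi * t : ℝ) : ℂ))

lemma expTwoPi_add (s t : ℝ) : expTwoPi (s + t) = expTwoPi s * expTwoPi t := by
  unfold expTwoPi
  rw [← Complex.exp_add]
  congr 1
  push_cast
  ring

lemma expTwoPi_zero : expTwoPi 0 = 1 := by simp [expTwoPi]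

lemma expTwoPi_intCast (n : ℤ) : expTwoPi n = 1 := by
  unfold expTwoPi
  rw [Complex.exp_eq_one_iff]
  exact ⟨n, by push_cast; ring⟩

lemma norm_expTwoPi (t : ℝ) : ‖expTwoPi t‖ = 1 := by
  unfold expTwoPi
  rw [mul_comm]
  exact Complex.norm_exp_ofReal_mul_I _

lemma conj_expTwoPi (t : ℝ) : (starRingEnd ℂ) (expTwoPi t) = expTwoPi (-t) := by
  unfold expTwoPi
  rw [← Complex.exp_conj, map_mul, Complex.conj_I, Complex.conj_ofReal]
  congr 1
  push_cast
  ring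

lemma expTwoPi_nat_mul (n : ℕ) (t : ℝ) : expTwoPi (n * t) = expTwoPi t ^ n := by
  unfold expTwoPi
  rw [← Complex.exp_nat_mul]
  congr 1
  push_cast
  ring

lemma expTwoPi_add_intCast (t : ℝ) (n : ℤ) : expTwoPi (t + n) = expTwoPi t := by
  rw [expTwoPi_add, expTwoPi_intCast, mul_one]

lemma expTwoPi_sum {ι : Type*} (s : Finset ι) (f : ι → ℝ) :
    expTwoPi (∑ i ∈ s, f i) = ∏ i ∈ s, expTwoPi (f i) := by
  classical
  induction s using Finset.induction_on with
  | empty => simp [expTwoPi_zero]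
  | insert a s ha ih => rw [Finset.sum_insert ha, Finset.prod_insert ha, expTwoPi_add, ih]

lemma four_mul_abs_le_norm_expTwoPi_sub_one {t : ℝ} (ht : |t| ≤ 1 / 2) :
    4 * |t| ≤ ‖expTwoPi t - 1‖ := by
  unfold expTwoPi
  rw [Complex.norm_exp_I_mul_ofReal_sub_one, Real.norm_eq_abs, abs_mul]
  have h1 : |Real.sin (2 * Real.pi * t / 2)| = Real.sin (Real.pi * |t|) := by
    have h2 : 2 * Real.pi * t / 2 = Real.pi * t := by ring
    have h5 : |Real.pi * t| = Real.pi * |t| := by rw [abs_mul, abs_of_pos Real.pi_pos]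
    rw [h2, ← h5]
    apply Real.abs_sin_eq_sin_abs_of_abs_le_pi
    rw [h5]
    nlinarith [Real.pi_pos]
  rw [h1]
  have h3 := Real.mul_le_sin (x := Real.pi * |t|) (by positivity) (by nlinarith [Real.pi_pos])
  have h4 : 2 / Real.pi * (Real.pi * |t|) = 2 * |t| := by
    field_simp
  rw [h4] at h3
  norm_num
  linarith

lemma norm_geom_expTwoPi_le {t : ℝ} (ht : |t| ≤ 1 / 2) (ht0 : t ≠ 0) (H : ℕ) :
    ‖∑ h ∈ Finset.range H, expTwoPi (h * t)‖ ≤ 1 / (2 * |t|) := by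
  have hpos : 0 < |t| := abs_pos.mpr ht0
  have h4 := four_mul_abs_le_norm_expTwoPi_sub_one ht
  have hne : expTwoPi t ≠ 1 := by
    intro h
    rw [h] at h4
    rw [sub_self, norm_zero] at h4
    linarith
  simp_rw [expTwoPi_nat_mul]
  rw [geom_sum_eq hne, norm_div, div_le_div_iff₀ (by linarith) (by linarith)]
  have : ‖expTwoPi t ^ H - 1‖ ≤ 2 := by
    refine (norm_sub_le _ _).trans ?_
    rw [norm_pow, norm_expTwoPi]
    norm_num
  nlinarith

lemma norm_geom_expTwoPi_le_card (t : ℝ) (H : ℕ) :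
    ‖∑ h ∈ Finset.range H, expTwoPi (h * t)‖ ≤ H := by
  refine (norm_sum_le _ _).trans ?_
  simp [norm_expTwoPi]

lemma sum_inv_sq_le_two (n : ℕ) : ∑ k ∈ Finset.Icc 1 n, 1 / (k : ℝ) ^ 2 ≤ 2 := by
  have h : ∀ m : ℕ, ∑ k ∈ Finset.Icc 1 (m + 1), 1 / (k : ℝ) ^ 2 ≤ 2 - 1 / ((m : ℝ) + 1) := by
    intro m
    induction m with
    | zero => simp; norm_num
    | succ m ih =>
      rw [Finset.sum_Icc_succ_top (by omega)]
      have : 1 / (((m + 1 + 1 : ℕ) : ℝ)) ^ 2 ≤ 1 / ((m : ℝ) + 1) - 1 / ((m : ℝ) + 1 + 1) := by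
        push_cast
        rw [div_sub_div _ _ (by positivity) (by positivity),
          div_le_div_iff₀ (by positivity) (by positivity)]
        nlinarith
      push_cast at *
      linarith
  rcases n with _ | m
  · simp
  · have := h m
    have h0 : (0 : ℝ) ≤ 1 / ((m : ℝ) + 1) := by positivity
    linarith

/-- A family of reals is `δ`-separated modulo one. -/
def SeparatedModOne {ι : Type*} (s : Finset ι) (α : ι → ℝ) (δ : ℝ) : Prop :=
  ∀ i ∈ s, ∀ j ∈ s, i ≠ j → ∀ m : ℤ, δ ≤ |α i - α j - m|

lemma SeparatedModOne.sum_norm_geom_sq_le {ι : Type*} {s : Finset ι} {α : ι → ℝ} {δ : ℝ}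
    (hδ : 0 < δ) (hs : SeparatedModOne s α δ) {i : ι} (hi : i ∈ s) (H : ℕ) :
    ∑ j ∈ s, ‖∑ h ∈ Finset.range H, expTwoPi (h * (α i - α j))‖ ^ 2 ≤ (H : ℝ) ^ 2 + 1 / δ ^ 2 := by
  classical
  rw [← Finset.add_sum_erase s _ hi]
  refine add_le_add (pow_le_pow_left₀ (norm_nonneg _) (norm_geom_expTwoPi_le_card _ _) 2) ?_
  set t : ι → ℝ := fun j => α i - α j - round (α i - α j) with ht
  have ht_half : ∀ j, |t j| ≤ 1 / 2 := fun j => abs_sub_round _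
  have ht_ge : ∀ j ∈ s.erase i, δ ≤ |t j| := fun j hj =>
    hs i hi j (Finset.mem_of_mem_erase hj) (Finset.ne_of_mem_erase hj).symm _
  set φ : ι → Bool × ℕ := fun j => (decide (0 ≤ t j), ⌊|t j| / δ⌋₊) with hφ
  set N : ℕ := ⌊1 / (2 * δ)⌋₊ with hN
  have hφ_mem : ∀ j ∈ s.erase i, φ j ∈ Finset.univ ×ˢ Finset.Icc 1 N := by
    intro j hj
    simp only [hφ, Finset.mem_product, Finset.mem_univ, true_and, Finset.mem_Icc]
    constructor
    · rw [Nat.one_le_floor_iff, le_div_iff₀ hδ]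
      linarith [ht_ge j hj]
    · apply Nat.floor_le_floor
      rw [div_le_div_iff₀ hδ (by positivity)]
      nlinarith [ht_half j]
  have hφ_inj : Set.InjOn φ (s.erase i : Finset ι) := by
    intro j hj k hk hjk
    by_contra hne
    have hj' := Finset.mem_coe.mp hj
    have hk' := Finset.mem_coe.mp hk
    simp only [hφ, Prod.mk.injEq, decide_eq_decide] at hjk
    obtain ⟨hsign, hfl⟩ := hjk
    have hsep := hs j (Finset.mem_of_mem_erase hj') k (Finset.mem_of_mem_erase hk') hne
      (round (α i - α k) - round (α i - α j))
    have heq : α j - α k - ((round (α i - α k) - round (α i - α j) : ℤ) : ℝ) = t k - t j := by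
      simp only [ht]
      push_cast
      ring
    rw [heq] at hsep
    have hclose : |(|t j| / δ - |t k| / δ)| < 1 := by
      have a1 := Nat.floor_le (show 0 ≤ |t j| / δ by positivity)
      have a2 := Nat.lt_floor_add_one (|t j| / δ)
      have b1 := Nat.floor_le (show 0 ≤ |t k| / δ by positivity)
      have b2 := Nat.lt_floor_add_one (|t k| / δ)
      rw [hfl] at a1 a2
      rw [abs_lt]
      constructor <;> linarith
    rw [← sub_div, abs_div, abs_of_pos hδ, div_lt_one hδ] at hclose
    have : |(|t j| - |t k|)| = |t k - t j| := by
      by_cases h0 : 0 ≤ t j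
      · rw [abs_of_nonneg h0, abs_of_nonneg (hsign.mp h0), abs_sub_comm]
      · have h1 : ¬ 0 ≤ t k := fun h => h0 (hsign.mpr h)
        push Not at h0 h1
        rw [abs_of_neg h0, abs_of_neg h1]
        congr 1
        ring
    linarith
  have hterm : ∀ j ∈ s.erase i, ‖∑ h ∈ Finset.range H, expTwoPi (h * (α i - α j))‖ ^ 2 ≤
      1 / (4 * δ ^ 2) * (1 / ((φ j).2 : ℝ) ^ 2) := by
    intro j hj
    have htpos : 0 < |t j| := lt_of_lt_of_le hδ (ht_ge j hj)
    have hsum : ∑ h ∈ Finset.range H, expTwoPi (h * (α i - α j)) =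
        ∑ h ∈ Finset.range H, expTwoPi (h * t j) := by
      refine Finset.sum_congr rfl fun h _ => ?_
      have : (h : ℝ) * (α i - α j) = h * t j + ((h * round (α i - α j) : ℤ) : ℝ) := by
        simp only [ht]
        push_cast
        ring
      rw [this, expTwoPi_add_intCast]
    rw [hsum]
    have h1 := norm_geom_expTwoPi_le (ht_half j) (abs_pos.mp htpos) H
    have hk1 : 1 ≤ (φ j).2 := (Finset.mem_Icc.mp (Finset.mem_product.mp (hφ_mem j hj)).2).1
    have hk : ((φ j).2 : ℝ) * δ ≤ |t j| := by
      have := Nat.floor_le (show 0 ≤ |t j| / δ by positivity)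
      rwa [le_div_iff₀ hδ] at this
    have hk1' : (1 : ℝ) ≤ ((φ j).2 : ℝ) := by exact_mod_cast hk1
    calc _ ≤ (1 / (2 * |t j|)) ^ 2 := pow_le_pow_left₀ (norm_nonneg _) h1 2
      _ ≤ (1 / (2 * (((φ j).2 : ℝ) * δ))) ^ 2 := by
          gcongr
      _ = _ := by
          field_simp
          ring
  calc _ ≤ ∑ j ∈ s.erase i, 1 / (4 * δ ^ 2) * (1 / ((φ j).2 : ℝ) ^ 2) := Finset.sum_le_sum hterm
    _ = ∑ b ∈ (s.erase i).image φ, 1 / (4 * δ ^ 2) * (1 / (b.2 : ℝ) ^ 2) :=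
        (Finset.sum_image (f := fun b : Bool × ℕ => 1 / (4 * δ ^ 2) * (1 / (b.2 : ℝ) ^ 2))
          hφ_inj).symm
    _ ≤ ∑ b ∈ (Finset.univ : Finset Bool) ×ˢ Finset.Icc 1 N,
          1 / (4 * δ ^ 2) * (1 / (b.2 : ℝ) ^ 2) := by
        refine Finset.sum_le_sum_of_subset_of_nonneg ?_ fun _ _ _ => by positivity
        exact Finset.image_subset_iff.mpr hφ_mem
    _ = 1 / (4 * δ ^ 2) * (2 * ∑ k ∈ Finset.Icc 1 N, 1 / (k : ℝ) ^ 2) := by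
        rw [← Finset.mul_sum, Finset.sum_product]
        simp
    _ ≤ 1 / (4 * δ ^ 2) * (2 * 2) := by
        gcongr
        exact sum_inv_sq_le_two N
    _ = 1 / δ ^ 2 := by field_simp; ring

lemma sum_sum_norm_sq_sub_le {ι : Type*} (s : Finset ι) (α : ι → ℝ) (c : ι → ℂ) (H : ℕ) {C : ℝ}
    (hC : ∀ i ∈ s, ∑ j ∈ s, ‖∑ h ∈ Finset.range H, expTwoPi (h * (α i - α j))‖ ^ 2 ≤ C) :
    ∑ h ∈ Finset.range H, ∑ k ∈ Finset.range H,
      ‖∑ i ∈ s, c i * expTwoPi (((h : ℝ) - k) * α i)‖ ^ 2 ≤ C * ∑ i ∈ s, ‖c i‖ ^ 2 := by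
  set D : ι → ι → ℂ := fun i j => ∑ h ∈ Finset.range H, expTwoPi (h * (α i - α j)) with hD
  have hconj : ∀ i j, (starRingEnd ℂ) (D i j) =
      ∑ k ∈ Finset.range H, expTwoPi (-(k : ℝ) * (α i - α j)) := by
    intro i j
    simp only [hD, map_sum, conj_expTwoPi, neg_mul]
  have key : ((∑ h ∈ Finset.range H, ∑ k ∈ Finset.range H,
      ‖∑ i ∈ s, c i * expTwoPi (((h : ℝ) - k) * α i)‖ ^ 2 : ℝ) : ℂ) =
      ∑ i ∈ s, ∑ j ∈ s, c i * (starRingEnd ℂ) (c j) * (D i j * (starRingEnd ℂ) (D i j)) := by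
    have hexp : ∀ h k : ℕ, ((‖∑ i ∈ s, c i * expTwoPi (((h : ℝ) - k) * α i)‖ ^ 2 : ℝ) : ℂ) =
        ∑ i ∈ s, ∑ j ∈ s, c i * (starRingEnd ℂ) (c j) *
          (expTwoPi (h * (α i - α j)) * expTwoPi (-(k : ℝ) * (α i - α j))) := by
      intro h k
      push_cast
      rw [← Complex.mul_conj', map_sum, Finset.sum_mul_sum]
      refine Finset.sum_congr rfl fun i _ => Finset.sum_congr rfl fun j _ => ?_
      rw [map_mul, conj_expTwoPi, ← expTwoPi_add, mul_mul_mul_comm, ← expTwoPi_add]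
      congr 2
      ring
    rw [Complex.ofReal_sum]
    simp_rw [Complex.ofReal_sum, hexp, hconj]
    simp only [hD]
    simp_rw [Finset.sum_mul_sum, Finset.mul_sum]
    calc _ = ∑ h ∈ Finset.range H, ∑ i ∈ s, ∑ k ∈ Finset.range H, ∑ j ∈ s,
        c i * (starRingEnd ℂ) (c j) *
          (expTwoPi (h * (α i - α j)) * expTwoPi (-(k : ℝ) * (α i - α j))) :=
          Finset.sum_congr rfl fun h _ => Finset.sum_comm
      _ = ∑ i ∈ s, ∑ h ∈ Finset.range H, ∑ k ∈ Finset.range H, ∑ j ∈ s, _ := Finset.sum_comm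
      _ = ∑ i ∈ s, ∑ h ∈ Finset.range H, ∑ j ∈ s, ∑ k ∈ Finset.range H, _ :=
          Finset.sum_congr rfl fun i _ => Finset.sum_congr rfl fun h _ => Finset.sum_comm
      _ = _ := Finset.sum_congr rfl fun i _ => Finset.sum_comm
  have hsymm : ∀ i j, ‖D i j‖ = ‖D j i‖ := by
    intro i j
    rw [← Complex.norm_conj, hconj]
    simp only [hD]
    congr 1
    refine Finset.sum_congr rfl fun k _ => ?_
    congr 1
    ring
  have hnn : 0 ≤ ∑ h ∈ Finset.range H, ∑ k ∈ Finset.range H,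
      ‖∑ i ∈ s, c i * expTwoPi (((h : ℝ) - k) * α i)‖ ^ 2 := by positivity
  have hnorm := congrArg norm key
  rw [Complex.norm_real, Real.norm_of_nonneg hnn] at hnorm
  rw [hnorm]
  calc _ ≤ ∑ i ∈ s, ∑ j ∈ s, ‖c i‖ * ‖c j‖ * ‖D i j‖ ^ 2 := by
        refine (norm_sum_le _ _).trans (Finset.sum_le_sum fun i _ => ?_)
        refine (norm_sum_le _ _).trans (Finset.sum_le_sum fun j _ => le_of_eq ?_)
        rw [norm_mul, norm_mul, norm_mul, Complex.norm_conj, Complex.norm_conj]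
        ring
    _ ≤ ∑ i ∈ s, ∑ j ∈ s, (‖c i‖ ^ 2 * ‖D i j‖ ^ 2 / 2 + ‖c j‖ ^ 2 * ‖D j i‖ ^ 2 / 2) := by
        refine Finset.sum_le_sum fun i _ => Finset.sum_le_sum fun j _ => ?_
        rw [hsymm j i]
        nlinarith [mul_nonneg (sq_nonneg (‖c i‖ - ‖c j‖)) (sq_nonneg ‖D i j‖)]
    _ = ∑ i ∈ s, ‖c i‖ ^ 2 * ∑ j ∈ s, ‖D i j‖ ^ 2 := by
        simp_rw [Finset.sum_add_distrib]
        rw [Finset.sum_comm (f := fun i j => ‖c j‖ ^ 2 * ‖D j i‖ ^ 2 / 2), ← Finset.sum_add_distrib]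
        refine Finset.sum_congr rfl fun i _ => ?_
        rw [← Finset.sum_add_distrib, Finset.mul_sum]
        exact Finset.sum_congr rfl fun j _ => by ring
    _ ≤ ∑ i ∈ s, ‖c i‖ ^ 2 * C := by
        refine Finset.sum_le_sum fun i hi => ?_
        exact mul_le_mul_of_nonneg_left (hC i hi) (by positivity)
    _ = _ := by rw [← Finset.sum_mul, mul_comm]

lemma mul_sum_Icc_le_sum_sum_sub {G : ℤ → ℝ} (hG : ∀ n, 0 ≤ G n) (M : ℕ) :
    (M : ℝ) * ∑ n ∈ Finset.Icc (-(M : ℤ)) M, G n ≤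
      ∑ h ∈ Finset.range (2 * M), ∑ k ∈ Finset.range (2 * M), G ((h : ℤ) - k) := by
  set φ : ℤ × ℕ → ℕ × ℕ := fun a => (a.1.toNat + a.2, (-a.1).toNat + a.2) with hφ
  set s := Finset.Icc (-(M : ℤ)) M ×ˢ Finset.range M with hs
  have hval : ∀ a : ℤ × ℕ, (((φ a).1 : ℕ) : ℤ) - ((φ a).2 : ℕ) = a.1 := by
    intro a
    simp only [hφ]
    omega
  have hinj : Set.InjOn φ s := by
    intro a _ b _ hab
    have h1 : a.1 = b.1 := by rw [← hval a, ← hval b, hab]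
    have h2 := congrArg Prod.fst hab
    simp only [hφ] at h2
    exact Prod.ext h1 (by rw [h1] at h2; omega)
  calc _ = ∑ a ∈ s, G a.1 := by
        rw [hs, Finset.sum_product]
        simp [Finset.mul_sum]
    _ = ∑ a ∈ s, G (((φ a).1 : ℕ) - ((φ a).2 : ℕ) : ℤ) := by simp_rw [hval]
    _ = ∑ b ∈ s.image φ, G ((b.1 : ℤ) - b.2) := (Finset.sum_image (f := fun b : ℕ × ℕ =>
        G ((b.1 : ℤ) - b.2)) hinj).symm
    _ ≤ ∑ b ∈ Finset.range (2 * M) ×ˢ Finset.range (2 * M), G ((b.1 : ℤ) - b.2) := by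
        refine Finset.sum_le_sum_of_subset_of_nonneg ?_ fun _ _ _ => hG _
        refine Finset.image_subset_iff.mpr fun a ha => ?_
        simp only [hs, Finset.mem_product, Finset.mem_Icc, Finset.mem_range] at ha
        simp only [hφ, Finset.mem_product, Finset.mem_range]
        omega
    _ = _ := Finset.sum_product _ _ _

/-- The dual large sieve inequality on the interval `[0, 2M]`, with the Fejér kernel. -/
theorem dual_large_sieve {ι : Type*} {s : Finset ι} {α : ι → ℝ} {δ : ℝ} (hδ : 0 < δ)
    (hs : SeparatedModOne s α δ) (c : ι → ℂ) (M : ℕ) :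
    (M : ℝ) * ∑ n ∈ Finset.range (2 * M + 1), ‖∑ i ∈ s, c i * expTwoPi (n * α i)‖ ^ 2 ≤
      ((2 * M : ℝ) ^ 2 + 1 / δ ^ 2) * ∑ i ∈ s, ‖c i‖ ^ 2 := by
  have h1 := sum_sum_norm_sq_sub_le s α (fun i => c i * expTwoPi (M * α i)) (2 * M)
    (C := (2 * M : ℝ) ^ 2 + 1 / δ ^ 2) (fun i hi => by
      have := hs.sum_norm_geom_sq_le hδ hi (2 * M)
      push_cast at this
      exact this)
  have h2 := mul_sum_Icc_le_sum_sum_sub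
    (G := fun n => ‖∑ i ∈ s, c i * expTwoPi (M * α i) * expTwoPi ((n : ℝ) * α i)‖ ^ 2)
    (fun n => by positivity) M
  have h3 : ∑ n ∈ Finset.Icc (-(M : ℤ)) M,
      ‖∑ i ∈ s, c i * expTwoPi (M * α i) * expTwoPi ((n : ℝ) * α i)‖ ^ 2 =
      ∑ n ∈ Finset.range (2 * M + 1), ‖∑ i ∈ s, c i * expTwoPi (n * α i)‖ ^ 2 := by
    symm
    refine Finset.sum_bij (fun n _ => (n : ℤ) - M) ?_ ?_ ?_ ?_
    · intro n hn
      simp only [Finset.mem_range, Finset.mem_Icc] at hn ⊢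
      omega
    · intro a _ b _ hab
      omega
    · intro b hb
      simp only [Finset.mem_Icc] at hb
      exact ⟨(b + M).toNat, by simp only [Finset.mem_range]; omega, by omega⟩
    · intro n _
      congr 2
      refine Finset.sum_congr rfl fun i _ => ?_
      rw [mul_assoc, ← expTwoPi_add]
      congr 2
      push_cast
      ring
  rw [h3] at h2
  refine h2.trans (le_trans (le_of_eq ?_) (h1.trans (le_of_eq ?_)))
  · push_cast
    rfl
  · simp [norm_expTwoPi]

lemma sum_zmod_eq_sum_range {E : Type*} [AddCommMonoid E] (p : ℕ) [NeZero p] (F : ZMod p → E) :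
    ∑ a : ZMod p, F a = ∑ a ∈ Finset.range p, F (a : ZMod p) := by
  symm
  refine Finset.sum_bij (fun a _ => (a : ZMod p)) (fun _ _ => Finset.mem_univ _) ?_ ?_ fun _ _ => rfl
  · intro a ha b hb hab
    rw [Finset.mem_range] at ha hb
    have := congrArg ZMod.val hab
    rwa [ZMod.val_cast_of_lt ha, ZMod.val_cast_of_lt hb] at this
  · intro b _
    exact ⟨b.val, Finset.mem_range.mpr (ZMod.val_lt b), ZMod.natCast_zmod_val b⟩

lemma stdAddChar_natCast_mul (p : ℕ) [NeZero p] (n a : ℕ) :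
    ZMod.stdAddChar ((n : ZMod p) * (a : ZMod p)) = expTwoPi (n * (a / p : ℝ)) := by
  have h := ZMod.stdAddChar_coe (N := p) ((n : ℤ) * a)
  push_cast at h
  rw [h, expTwoPi]
  congr 1
  push_cast
  ring

/-- Fourier expansion and Parseval identity for a mean-zero function on `ℤ / p`. -/
lemma exists_fourier_of_sum_eq_zero (p : ℕ) [NeZero p] (f : ZMod p → ℂ) (hf : ∑ a, f a = 0) :
    ∃ c : ℕ → ℂ, (∀ n : ℕ, f n = ∑ a ∈ Finset.Ico 1 p, c a * expTwoPi (n * (a / p : ℝ))) ∧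
      (p : ℝ) * ∑ a ∈ Finset.Ico 1 p, ‖c a‖ ^ 2 = ∑ a, ‖f a‖ ^ 2 := by
  have hp : (p : ℂ) ≠ 0 := Nat.cast_ne_zero.mpr (NeZero.ne p)
  set d : ZMod p → ℂ := fun k => (p : ℂ)⁻¹ * ZMod.dft f k with hd
  have hd0 : d 0 = 0 := by
    simp only [hd]
    rw [ZMod.dft_apply_zero, hf, mul_zero]
  have hinv : ∀ j, f j = ∑ k, d k * ZMod.stdAddChar (j * k) := by
    intro j
    have h := ZMod.invDFT_apply (ZMod.dft f) j
    rw [LinearEquiv.symm_apply_apply] at h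
    rw [h, smul_eq_mul, Finset.mul_sum]
    refine Finset.sum_congr rfl fun k _ => ?_
    rw [smul_eq_mul, mul_comm k j]
    simp only [hd]
    ring
  have hrange : ∀ F : ZMod p → ℂ, F 0 = 0 →
      ∑ a, F a = ∑ a ∈ Finset.Ico 1 p, F (a : ZMod p) := by
    intro F hF
    rw [sum_zmod_eq_sum_range, Finset.range_eq_Ico,
      Finset.sum_eq_sum_Ico_succ_bot (Nat.pos_of_ne_zero (NeZero.ne p))]
    simp [hF]
  refine ⟨fun a => d a, fun n => ?_, ?_⟩
  · rw [hinv, hrange _ (by rw [hd0, zero_mul])]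
    exact Finset.sum_congr rfl fun a _ => by rw [stdAddChar_natCast_mul]
  · have hconj : ∀ k, (p : ℂ) * (starRingEnd ℂ) (d k) =
        ∑ j, (starRingEnd ℂ) (f j) * ZMod.stdAddChar (j * k) := by
      intro k
      simp only [hd]
      rw [ZMod.dft_apply, map_mul, map_inv₀, Complex.conj_natCast, mul_inv_cancel_left₀ hp, map_sum]
      refine Finset.sum_congr rfl fun j _ => ?_
      rw [smul_eq_mul, map_mul, mul_comm, ← AddChar.map_neg_eq_conj, neg_neg]
    have hpars : (p : ℂ) * ∑ k, d k * (starRingEnd ℂ) (d k) = ∑ j, f j * (starRingEnd ℂ) (f j) := by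
      calc _ = ∑ k, d k * ((p : ℂ) * (starRingEnd ℂ) (d k)) := by
            rw [Finset.mul_sum]
            exact Finset.sum_congr rfl fun k _ => by ring
        _ = ∑ k, ∑ j, (starRingEnd ℂ) (f j) * (d k * ZMod.stdAddChar (j * k)) := by
            refine Finset.sum_congr rfl fun k _ => ?_
            rw [hconj, Finset.mul_sum]
            exact Finset.sum_congr rfl fun j _ => by ring
        _ = ∑ j, (starRingEnd ℂ) (f j) * ∑ k, d k * ZMod.stdAddChar (j * k) := by
            rw [Finset.sum_comm]
            exact Finset.sum_congr rfl fun j _ => by rw [Finset.mul_sum]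
        _ = _ := Finset.sum_congr rfl fun j _ => by rw [← hinv, mul_comm]
    rw [hrange _ (by rw [hd0, zero_mul])] at hpars
    simp only [Complex.mul_conj'] at hpars
    exact_mod_cast hpars

/-- The weight `ω / (p - ω)` of a prime `p` modulo which `ω` residue classes are removed. -/
noncomputable def sieveWeight (p : ℕ) (Ω : Finset (ZMod p)) : ℝ :=
  (Ω.card : ℝ) / ((p : ℝ) - Ω.card)

/-- The mean-zero function modulo `p` equal to `-1` on the removed classes and constant on the
remaining ones has a Fourier expansion without constant term. -/
lemma exists_fourier_sieve (p : ℕ) (hp : p.Prime) (Ω : Finset (ZMod p)) (hΩ : Ω.card < p) :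
    ∃ (f : ℕ → ℂ) (c : ℕ → ℂ), (∀ n : ℕ, (n : ZMod p) ∉ Ω → f n = (sieveWeight p Ω : ℝ)) ∧
      (∀ n : ℕ, f n = ∑ a ∈ Finset.Ico 1 p, c a * expTwoPi (n * (a / p : ℝ))) ∧
      ∑ a ∈ Finset.Ico 1 p, ‖c a‖ ^ 2 = sieveWeight p Ω := by
  classical
  have : NeZero p := ⟨hp.ne_zero⟩
  set g := sieveWeight p Ω with hg
  have hp0 : (0 : ℝ) < p := by exact_mod_cast hp.pos
  have hlt : (0 : ℝ) < (p : ℝ) - Ω.card := by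
    have : (Ω.card : ℝ) < p := by exact_mod_cast hΩ
    linarith
  have hgmul : ((p : ℝ) - Ω.card) * g = Ω.card := by
    rw [hg, sieveWeight]
    field_simp
  have hsum : ∀ u v : ℝ, ∑ a : ZMod p, (if a ∈ Ω then u else v) =
      Ω.card * u + ((p : ℝ) - Ω.card) * v := by
    intro u v
    rw [Finset.sum_ite, Finset.sum_const, Finset.sum_const, Finset.filter_mem_eq_inter,
      Finset.univ_inter, Finset.filter_notMem_eq_sdiff, Finset.card_univ_sdiff, ZMod.card,
      nsmul_eq_mul, nsmul_eq_mul, Nat.cast_sub hΩ.le]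
  obtain ⟨c, hc1, hc2⟩ := exists_fourier_of_sum_eq_zero p
    (fun a => (((if a ∈ Ω then -1 else g : ℝ)) : ℂ)) (by
      rw [← Complex.ofReal_sum, hsum]
      rw [hgmul]
      simp)
  refine ⟨fun n => (((if (n : ZMod p) ∈ Ω then -1 else g : ℝ)) : ℂ), c, fun n hn => ?_,
    fun n => hc1 n, ?_⟩
  · simp [hn]
  · have h1 : ∑ a : ZMod p, ‖(((if a ∈ Ω then -1 else g : ℝ)) : ℂ)‖ ^ 2 = p * g := by
      calc _ = ∑ a : ZMod p, (if a ∈ Ω then (1 : ℝ) else g ^ 2) := by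
            refine Finset.sum_congr rfl fun a _ => ?_
            split_ifs <;> simp
        _ = Ω.card * 1 + ((p : ℝ) - Ω.card) * g * g := by
            rw [hsum]
            ring
        _ = _ := by
            rw [hgmul]
            linear_combination -hgmul
    rw [h1] at hc2
    exact mul_left_cancel₀ hp0.ne' hc2

/-- A fraction with squarefree denominator that is not an integer stays away from the integers. -/
lemma one_div_prod_le_abs_sum_div_sub {U : Finset ℕ} (hU : ∀ p ∈ U, p.Prime) (w : ℕ → ℤ)
    {q : ℕ} (hq : q ∈ U) (hw : ¬ (q : ℤ) ∣ w q) (m : ℤ) :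
    1 / ((∏ p ∈ U, p : ℕ) : ℝ) ≤ |∑ p ∈ U, (w p : ℝ) / p - m| := by
  set z : ℤ := ∑ p ∈ U, w p * ∏ r ∈ U.erase p, (r : ℤ) - m * ∏ p ∈ U, (p : ℤ) with hz
  have hDpos : (0 : ℝ) < ((∏ p ∈ U, p : ℕ) : ℝ) := by
    exact_mod_cast Finset.prod_pos fun p hp => (hU p hp).pos
  have hzeq : (z : ℝ) = ((∏ p ∈ U, p : ℕ) : ℝ) * (∑ p ∈ U, (w p : ℝ) / p - m) := by
    rw [mul_sub, Finset.mul_sum, hz]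
    push_cast
    congr 1
    · refine Finset.sum_congr rfl fun p hp => ?_
      rw [← Finset.mul_prod_erase U _ hp]
      have : (p : ℝ) ≠ 0 := by exact_mod_cast (hU p hp).ne_zero
      field_simp
    · ring
  have hz0 : z ≠ 0 := by
    intro h0
    have hdvd : (q : ℤ) ∣ w q * ∏ r ∈ U.erase q, (r : ℤ) := by
      have h1 : (q : ℤ) ∣ ∑ p ∈ U.erase q, w p * ∏ r ∈ U.erase p, (r : ℤ) := by
        refine Finset.dvd_sum fun p hp => Dvd.dvd.mul_left ?_ _
        exact Finset.dvd_prod_of_mem _ (Finset.mem_erase.mpr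
          ⟨(Finset.ne_of_mem_erase hp).symm, hq⟩)
      have h2 : (q : ℤ) ∣ m * ∏ p ∈ U, (p : ℤ) :=
        Dvd.dvd.mul_left (Finset.dvd_prod_of_mem _ hq) _
      have h3 : w q * ∏ r ∈ U.erase q, (r : ℤ) =
          z + m * ∏ p ∈ U, (p : ℤ) - ∑ p ∈ U.erase q, w p * ∏ r ∈ U.erase p, (r : ℤ) := by
        rw [hz, ← Finset.add_sum_erase U _ hq]
        ring
      rw [h3, h0, zero_add]
      exact dvd_sub h2 h1
    have hqp : Prime (q : ℤ) := Nat.prime_iff_prime_int.mp (hU q hq)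
    rcases hqp.dvd_or_dvd hdvd with h | h
    · exact hw h
    · obtain ⟨r, hr, hqr⟩ := (hqp.dvd_finsetProd_iff _).mp h
      have := (Nat.prime_dvd_prime_iff_eq (hU q hq) (hU r (Finset.mem_of_mem_erase hr))).mp
        (by exact_mod_cast hqr)
      exact Finset.ne_of_mem_erase hr this.symm
  have h1 : (1 : ℝ) ≤ |(z : ℝ)| := by
    exact_mod_cast Int.one_le_abs hz0
  rw [hzeq, abs_mul, abs_of_pos hDpos] at h1
  rw [div_le_iff₀ hDpos]
  linarith

/-- Extension by zero of a dependent function on a finset. -/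
noncomputable def extendZero {I : Finset ℕ} (a : ∀ p ∈ I, ℕ) (p : ℕ) : ℕ :=
  by classical exact if h : p ∈ I then a p h else 0

lemma extendZero_of_mem {I : Finset ℕ} (a : ∀ p ∈ I, ℕ) {p : ℕ} (h : p ∈ I) :
    extendZero a p = a p h := by simp [extendZero, h]

lemma extendZero_of_notMem {I : Finset ℕ} (a : ∀ p ∈ I, ℕ) {p : ℕ} (h : p ∉ I) :
    extendZero a p = 0 := by simp [extendZero, h]

/-- The arithmetic form of the large sieve. -/
theorem arithmetic_large_sieve {P : Finset ℕ} (hP : ∀ p ∈ P, p.Prime)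
    (Ω : (p : ℕ) → Finset (ZMod p)) (hΩ : ∀ p ∈ P, (Ω p).card < p)
    {𝒬 : Finset (Finset ℕ)} (h𝒬 : ∀ I ∈ 𝒬, I ⊆ P) {Q : ℝ} (hQ : 0 < Q)
    (hQI : ∀ I ∈ 𝒬, ((∏ p ∈ I, p : ℕ) : ℝ) ≤ Q) {M : ℕ} {B : Finset ℕ}
    (hB : ∀ b ∈ B, b ≤ 2 * M) (hBΩ : ∀ b ∈ B, ∀ p ∈ P, (b : ZMod p) ∉ Ω p) :
    (M : ℝ) * (B.card * ∑ I ∈ 𝒬, ∏ p ∈ I, sieveWeight p (Ω p)) ≤ (2 * M : ℝ) ^ 2 + Q ^ 4 := by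
  classical
  choose! f c hfΩ hfc hcnorm using fun p (hp : p ∈ P) =>
    exists_fourier_sieve p (hP p hp) (Ω p) (hΩ p hp)
  set L := ∑ I ∈ 𝒬, ∏ p ∈ I, sieveWeight p (Ω p) with hL
  have hw0 : ∀ p ∈ P, 0 ≤ sieveWeight p (Ω p) := by
    intro p hp
    have : ((Ω p).card : ℝ) < p := by exact_mod_cast hΩ p hp
    exact div_nonneg (by positivity) (by linarith)
  have hL0 : 0 ≤ L := Finset.sum_nonneg fun I hI => Finset.prod_nonneg fun p hp =>
    hw0 p (h𝒬 I hI hp)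
  set s : Finset (Σ I : Finset ℕ, ∀ p ∈ I, ℕ) :=
    𝒬.sigma fun I => I.pi fun p => Finset.Ico 1 p with hs
  set α : (Σ I : Finset ℕ, ∀ p ∈ I, ℕ) → ℝ := fun i =>
    ∑ x ∈ i.1.attach, (i.2 x.1 x.2 : ℝ) / (x.1 : ℝ) with hα
  set C : (Σ I : Finset ℕ, ∀ p ∈ I, ℕ) → ℂ := fun i =>
    ∏ x ∈ i.1.attach, c x.1 (i.2 x.1 x.2) with hC
  have hsep : SeparatedModOne s α (1 / Q ^ 2) := by
    rintro ⟨I, a⟩ hi ⟨J, b⟩ hj hne m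
    simp only [hs, Finset.mem_sigma, Finset.mem_pi, Finset.mem_Ico] at hi hj
    obtain ⟨hI, ha⟩ := hi
    obtain ⟨hJ, hb⟩ := hj
    have hUP : ∀ p ∈ I ∪ J, p.Prime := fun p hp =>
      hP p ((Finset.mem_union.mp hp).elim (fun h => h𝒬 I hI h) fun h => h𝒬 J hJ h)
    have hext : ∀ {K : Finset ℕ} (d : ∀ p ∈ K, ℕ), K ⊆ I ∪ J →
        ∑ x ∈ K.attach, (d x.1 x.2 : ℝ) / (x.1 : ℝ) =
          ∑ p ∈ I ∪ J, (extendZero d p : ℝ) / p := by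
      intro K d hK
      rw [← Finset.sum_subset hK (fun p _ hp => by simp [extendZero_of_notMem d hp]),
        ← Finset.sum_attach K]
      exact Finset.sum_congr rfl fun x _ => by rw [extendZero_of_mem d x.2]
    have hdiff : ∃ q ∈ I ∪ J, extendZero a q ≠ extendZero b q := by
      by_contra hcon
      push Not at hcon
      apply hne
      have hIJ : I = J := by
        ext p
        constructor
        · intro hp
          by_contra hpJ
          have h1 := hcon p (Finset.mem_union_left _ hp)
          rw [extendZero_of_mem a hp, extendZero_of_notMem b hpJ] at h1
          have := (ha p hp).1
          omega
        · intro hp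
          by_contra hpI
          have h1 := hcon p (Finset.mem_union_right _ hp)
          rw [extendZero_of_mem b hp, extendZero_of_notMem a hpI] at h1
          have := (hb p hp).1
          omega
      subst hIJ
      congr 1
      funext p hp
      have h1 := hcon p (Finset.mem_union_left _ hp)
      rwa [extendZero_of_mem a hp, extendZero_of_mem b hp] at h1
    obtain ⟨q, hq, hqne⟩ := hdiff
    have hlt : ∀ {K : Finset ℕ} (d : ∀ p ∈ K, ℕ), (∀ p hp, 1 ≤ d p hp ∧ d p hp < p) →
        extendZero d q < q := by
      intro K d hd
      by_cases hqK : q ∈ K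
      · rw [extendZero_of_mem d hqK]
        exact (hd q hqK).2
      · rw [extendZero_of_notMem d hqK]
        exact (hUP q hq).pos
    have hndvd : ¬ (q : ℤ) ∣ (extendZero a q : ℤ) - extendZero b q := by
      intro hdvd
      have h1 := hlt a ha
      have h2 := hlt b hb
      have h3 := Int.eq_zero_of_abs_lt_dvd hdvd (by rw [abs_lt]; constructor <;> omega)
      omega
    have key := one_div_prod_le_abs_sum_div_sub hUP
      (fun p => (extendZero a p : ℤ) - extendZero b p) hq hndvd m
    have heq : α ⟨I, a⟩ - α ⟨J, b⟩ =
        ∑ p ∈ I ∪ J, (((extendZero a p : ℤ) - extendZero b p : ℤ) : ℝ) / p := by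
      simp only [hα]
      rw [hext a Finset.subset_union_left, hext b Finset.subset_union_right,
        ← Finset.sum_sub_distrib]
      refine Finset.sum_congr rfl fun p _ => ?_
      push_cast
      ring
    rw [heq]
    refine le_trans ?_ key
    have hUpos : 0 < ∏ p ∈ I ∪ J, p := Finset.prod_pos fun p hp => (hUP p hp).pos
    have hUle : ∏ p ∈ I ∪ J, p ≤ (∏ p ∈ I, p) * ∏ p ∈ J, p := by
      rw [← Finset.prod_union_inter]
      refine Nat.le_mul_of_pos_right _ (Finset.prod_pos fun p hp => ?_)
      exact (hUP p (Finset.mem_union_left _ (Finset.mem_inter.mp hp).1)).pos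
    have hUle' : ((∏ p ∈ I ∪ J, p : ℕ) : ℝ) ≤ Q ^ 2 := by
      calc ((∏ p ∈ I ∪ J, p : ℕ) : ℝ) ≤ ((∏ p ∈ I, p : ℕ) : ℝ) * ((∏ p ∈ J, p : ℕ) : ℝ) := by
            exact_mod_cast hUle
        _ ≤ Q * Q := mul_le_mul (hQI I hI) (hQI J hJ) (by positivity) hQ.le
        _ = Q ^ 2 := by ring
    exact one_div_le_one_div_of_le (by exact_mod_cast hUpos) hUle'
  have hF : ∀ n : ℕ, ∑ I ∈ 𝒬, ∏ p ∈ I, f p n = ∑ i ∈ s, C i * expTwoPi (n * α i) := by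
    intro n
    rw [hs, Finset.sum_sigma]
    refine Finset.sum_congr rfl fun I hI => ?_
    rw [Finset.prod_congr rfl fun p hp => hfc p (h𝒬 I hI hp) n, Finset.prod_sum]
    refine Finset.sum_congr rfl fun a _ => ?_
    simp only [hC, hα]
    rw [Finset.prod_mul_distrib, Finset.mul_sum, expTwoPi_sum]
  have hE : ∑ i ∈ s, ‖C i‖ ^ 2 = L := by
    rw [hs, Finset.sum_sigma, hL]
    refine Finset.sum_congr rfl fun I hI => ?_
    rw [← Finset.prod_congr rfl fun p hp => hcnorm p (h𝒬 I hI hp), Finset.prod_sum]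
    refine Finset.sum_congr rfl fun a _ => ?_
    simp only [hC]
    rw [norm_prod, Finset.prod_pow]
  have hls := dual_large_sieve (by positivity) hsep C M
  rw [hE] at hls
  simp_rw [← hF] at hls
  have hlow : B.card * L ^ 2 ≤
      ∑ n ∈ Finset.range (2 * M + 1), ‖∑ I ∈ 𝒬, ∏ p ∈ I, f p n‖ ^ 2 := by
    calc B.card * L ^ 2 = ∑ b ∈ B, ‖∑ I ∈ 𝒬, ∏ p ∈ I, f p b‖ ^ 2 := by
          rw [← nsmul_eq_mul, ← Finset.sum_const]
          refine Finset.sum_congr rfl fun b hb => ?_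
          have : ∑ I ∈ 𝒬, ∏ p ∈ I, f p b = (L : ℂ) := by
            rw [hL]
            push_cast
            refine Finset.sum_congr rfl fun I hI => Finset.prod_congr rfl fun p hp => ?_
            exact hfΩ p (h𝒬 I hI hp) b (hBΩ b hb p (h𝒬 I hI hp))
          rw [this, Complex.norm_real, Real.norm_of_nonneg hL0]
      _ ≤ _ := by
          refine Finset.sum_le_sum_of_subset_of_nonneg (fun b hb => ?_) fun _ _ _ => by positivity
          exact Finset.mem_range.mpr (Nat.lt_succ_of_le (hB b hb))
  rcases hL0.eq_or_lt with h0 | hpos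
  · rw [← h0]
    simp only [mul_zero]
    positivity
  · have h1 : (M : ℝ) * (B.card * L ^ 2) ≤ ((2 * M : ℝ) ^ 2 + 1 / (1 / Q ^ 2) ^ 2) * L :=
      (mul_le_mul_of_nonneg_left hlow (by positivity)).trans hls
    have h2 : 1 / (1 / Q ^ 2) ^ 2 = Q ^ 4 := by
      field_simp
    rw [h2] at h1
    refine le_of_mul_le_mul_right (le_trans (le_of_eq ?_) h1) hpos
    ring

section SelbergSieve

variable {ι : Type*} [DecidableEq ι]

/-- The Selberg form: the sum over `I ∈ 𝒬` of the products of `-1` (on `X`) and `g` (off `X`). -/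
def selbergForm (𝒬 : Finset (Finset ι)) (g : ι → ℝ) (X : Finset ι) : ℝ :=
  ∑ I ∈ 𝒬, ∏ p ∈ I, if p ∈ X then -1 else g p

/-- The coefficients of the Selberg form with respect to the indicator functions of `D ⊆ X`. -/
def selbergCoeff (𝒬 : Finset (Finset ι)) (g : ι → ℝ) (D : Finset ι) : ℝ :=
  ∑ I ∈ 𝒬 with D ⊆ I, (∏ p ∈ D, -(1 + g p)) * ∏ p ∈ I \ D, g p

lemma selbergForm_eq_sum_coeff {𝒬 : Finset (Finset ι)} (h𝒬 : ∀ I ∈ 𝒬, ∀ J ⊆ I, J ∈ 𝒬)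
    (g : ι → ℝ) (X : Finset ι) :
    selbergForm 𝒬 g X = ∑ D ∈ 𝒬, selbergCoeff 𝒬 g D * if D ⊆ X then 1 else 0 := by
  have h1 : ∀ I : Finset ι, (∏ p ∈ I, if p ∈ X then (-1 : ℝ) else g p) =
      ∑ D ∈ I.powerset, ((∏ p ∈ D, -(1 + g p)) * ∏ p ∈ I \ D, g p) * if D ⊆ X then 1 else 0 := by
    intro I
    have : ∀ p ∈ I, (if p ∈ X then (-1 : ℝ) else g p) =
        -(1 + g p) * (if p ∈ X then 1 else 0) + g p := by
      intro p _
      split_ifs <;> ring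
    rw [Finset.prod_congr rfl this, Finset.prod_add]
    refine Finset.sum_congr rfl fun D _ => ?_
    rw [Finset.prod_mul_distrib, Finset.prod_ite_zero, Finset.prod_const_one]
    simp only [Finset.subset_iff]
    ring
  unfold selbergForm selbergCoeff
  simp_rw [h1, Finset.sum_mul]
  rw [Finset.sum_comm' (t' := 𝒬) (s' := fun D => {I ∈ 𝒬 | D ⊆ I})]
  intro I D
  simp only [Finset.mem_powerset, Finset.mem_filter]
  exact ⟨fun h => ⟨h, h𝒬 I h.1 D h.2⟩, fun h => h.1⟩

lemma abs_selbergCoeff_le {𝒬 : Finset (Finset ι)} (h𝒬 : ∀ I ∈ 𝒬, ∀ J ⊆ I, J ∈ 𝒬)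
    {g : ι → ℝ} (hg : ∀ I ∈ 𝒬, ∀ p ∈ I, 0 ≤ g p) {D : Finset ι} (hD : D ∈ 𝒬) :
    |selbergCoeff 𝒬 g D| ≤ ∑ I ∈ 𝒬, ∏ p ∈ I, g p := by
  unfold selbergCoeff
  rw [← Finset.mul_sum, abs_mul, Finset.abs_prod]
  have h1 : ∏ p ∈ D, |-(1 + g p)| = ∑ J ∈ D.powerset, ∏ p ∈ J, g p := by
    rw [← Finset.prod_one_add]
    refine Finset.prod_congr rfl fun p hp => ?_
    rw [abs_neg, abs_of_nonneg (by linarith [hg D hD p hp])]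
  have h2 : |∑ I ∈ 𝒬 with D ⊆ I, ∏ p ∈ I \ D, g p| = ∑ I ∈ 𝒬 with D ⊆ I, ∏ p ∈ I \ D, g p := by
    refine abs_of_nonneg (Finset.sum_nonneg fun I hI => Finset.prod_nonneg fun p hp => ?_)
    exact hg I (Finset.mem_filter.mp hI).1 p (Finset.mem_sdiff.mp hp).1
  rw [h1, h2, Finset.sum_mul_sum, ← Finset.sum_product']
  set φ : Finset ι × Finset ι → Finset ι := fun a => a.1 ∪ (a.2 \ D) with hφ
  have hmem : ∀ a ∈ D.powerset ×ˢ {I ∈ 𝒬 | D ⊆ I}, a.1 ⊆ D ∧ a.2 ∈ 𝒬 ∧ D ⊆ a.2 := by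
    intro a ha
    simpa using ha
  have hinj : Set.InjOn φ (D.powerset ×ˢ {I ∈ 𝒬 | D ⊆ I} : Finset (Finset ι × Finset ι)) := by
    intro a ha b hb hab
    obtain ⟨ha1, ha2, ha3⟩ := hmem a ha
    obtain ⟨hb1, hb2, hb3⟩ := hmem b hb
    simp only [hφ, Finset.ext_iff, Finset.mem_union, Finset.mem_sdiff] at hab
    refine Prod.ext (Finset.ext fun p => ?_) (Finset.ext fun p => ?_)
    · have := hab p
      have := @ha1 p
      have := @hb1 p
      tauto
    · have := hab p
      have := @ha1 p
      have := @hb1 p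
      have := @ha3 p
      have := @hb3 p
      tauto
  calc _ = ∑ a ∈ D.powerset ×ˢ {I ∈ 𝒬 | D ⊆ I}, ∏ p ∈ φ a, g p := by
        refine Finset.sum_congr rfl fun a ha => ?_
        simp only [hφ]
        rw [Finset.prod_union]
        exact Finset.disjoint_of_subset_left (hmem a ha).1 Finset.disjoint_sdiff
    _ = ∑ K ∈ (D.powerset ×ˢ {I ∈ 𝒬 | D ⊆ I}).image φ, ∏ p ∈ K, g p :=
        (Finset.sum_image (f := fun K => ∏ p ∈ K, g p) hinj).symm
    _ ≤ _ := by
        refine Finset.sum_le_sum_of_subset_of_nonneg (Finset.image_subset_iff.mpr fun a ha => ?_)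
          fun I hI _ => Finset.prod_nonneg (hg I hI)
        obtain ⟨ha1, ha2, ha3⟩ := hmem a ha
        exact h𝒬 _ ha2 _ (Finset.union_subset (ha1.trans ha3) Finset.sdiff_subset)

/-- The sum over subsets `X ⊆ P` of a product of local factors, with Bernoulli weights. -/
lemma sum_powerset_bernoulli (P : Finset ι) (h u v : ι → ℝ) :
    ∑ X ∈ P.powerset, ((∏ p ∈ X, h p) * ∏ p ∈ P \ X, (1 - h p)) *
      ∏ p ∈ P, (if p ∈ X then u p else v p) = ∏ p ∈ P, (h p * u p + (1 - h p) * v p) := by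
  rw [Finset.prod_add]
  refine Finset.sum_congr rfl fun X hX => ?_
  have hXP := Finset.mem_powerset.mp hX
  rw [← Finset.prod_sdiff hXP (f := fun p => if p ∈ X then u p else v p),
    Finset.prod_congr rfl (g := v) fun p hp => if_neg (Finset.mem_sdiff.mp hp).2,
    Finset.prod_congr rfl (s₁ := X) (g := u) fun p hp => if_pos hp,
    Finset.prod_mul_distrib, Finset.prod_mul_distrib]
  ring

lemma prod_subset_eq_prod_ite {P I : Finset ι} (hI : I ⊆ P) (f : ι → ℝ) :
    ∏ p ∈ I, f p = ∏ p ∈ P, if p ∈ I then f p else 1 := by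
  rw [Finset.prod_ite_mem, Finset.inter_eq_right.mpr hI]

lemma sum_sum_selbergCoeff_mul {P : Finset ι} {𝒬 : Finset (Finset ι)}
    (h𝒬 : ∀ I ∈ 𝒬, ∀ J ⊆ I, J ∈ 𝒬) (h𝒬P : ∀ I ∈ 𝒬, I ⊆ P) {h g : ι → ℝ}
    (hg : ∀ p ∈ P, (1 - h p) * g p = h p) :
    ∑ D ∈ 𝒬, ∑ E ∈ 𝒬, selbergCoeff 𝒬 g D * selbergCoeff 𝒬 g E * ∏ p ∈ D ∪ E, h p =
      ∑ I ∈ 𝒬, ∏ p ∈ I, g p := by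
  set W : Finset ι → ℝ := fun X => (∏ p ∈ X, h p) * ∏ p ∈ P \ X, (1 - h p) with hW
  have hD : ∀ D ⊆ P, ∑ X ∈ P.powerset, W X * (if D ⊆ X then 1 else 0) = ∏ p ∈ D, h p := by
    intro D hDP
    have h1 := sum_powerset_bernoulli P h (fun _ => 1) (fun p => if p ∈ D then 0 else 1)
    have h2 : ∏ p ∈ P, (h p * 1 + (1 - h p) * (if p ∈ D then 0 else 1)) = ∏ p ∈ D, h p := by
      rw [prod_subset_eq_prod_ite hDP]
      refine Finset.prod_congr rfl fun p _ => ?_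
      split_ifs <;> ring
    rw [← h2, ← h1]
    refine Finset.sum_congr rfl fun X hX => ?_
    congr 1
    have h3 : ∀ p ∈ P, (if p ∈ X then (1 : ℝ) else if p ∈ D then 0 else 1) =
        if (p ∈ D → p ∈ X) then 1 else 0 := by
      intro p _
      by_cases hpX : p ∈ X <;> by_cases hpD : p ∈ D <;> simp [hpX, hpD]
    rw [Finset.prod_congr rfl h3, Finset.prod_ite_zero, Finset.prod_const_one]
    congr 1
    rw [eq_iff_iff]
    exact ⟨fun h p _ hp => h hp, fun h p hp => h p (hDP hp) hp⟩
  have hL : ∑ X ∈ P.powerset, W X * selbergForm 𝒬 g X ^ 2 =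
      ∑ D ∈ 𝒬, ∑ E ∈ 𝒬, selbergCoeff 𝒬 g D * selbergCoeff 𝒬 g E * ∏ p ∈ D ∪ E, h p := by
    calc _ = ∑ X ∈ P.powerset, ∑ D ∈ 𝒬, ∑ E ∈ 𝒬,
          selbergCoeff 𝒬 g D * selbergCoeff 𝒬 g E * (W X * if D ∪ E ⊆ X then 1 else 0) := by
          refine Finset.sum_congr rfl fun X _ => ?_
          rw [selbergForm_eq_sum_coeff h𝒬, sq, Finset.sum_mul_sum, Finset.mul_sum]
          refine Finset.sum_congr rfl fun D _ => ?_
          rw [Finset.mul_sum]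
          refine Finset.sum_congr rfl fun E _ => ?_
          by_cases hDX : D ⊆ X <;> by_cases hEX : E ⊆ X <;>
            simp [Finset.union_subset_iff, hDX, hEX, mul_comm]
      _ = _ := by
          rw [Finset.sum_comm]
          refine Finset.sum_congr rfl fun D hDQ => ?_
          rw [Finset.sum_comm]
          refine Finset.sum_congr rfl fun E hEQ => ?_
          rw [← Finset.mul_sum, hD _ (Finset.union_subset (h𝒬P D hDQ) (h𝒬P E hEQ))]
  rw [← hL]
  calc _ = ∑ X ∈ P.powerset, ∑ I ∈ 𝒬, ∑ J ∈ 𝒬, W X *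
        ∏ p ∈ P, (if p ∈ X then (if p ∈ I then (-1 : ℝ) else 1) * (if p ∈ J then -1 else 1)
          else (if p ∈ I then g p else 1) * (if p ∈ J then g p else 1)) := by
        refine Finset.sum_congr rfl fun X _ => ?_
        rw [selbergForm, sq, Finset.sum_mul_sum, Finset.mul_sum]
        refine Finset.sum_congr rfl fun I hI => ?_
        rw [Finset.mul_sum]
        refine Finset.sum_congr rfl fun J hJ => ?_
        rw [prod_subset_eq_prod_ite (h𝒬P I hI), prod_subset_eq_prod_ite (h𝒬P J hJ),
          ← Finset.prod_mul_distrib]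
        congr 1
        refine Finset.prod_congr rfl fun p _ => ?_
        split_ifs <;> rfl
    _ = ∑ I ∈ 𝒬, ∑ J ∈ 𝒬, ∏ p ∈ P,
        (h p * ((if p ∈ I then (-1 : ℝ) else 1) * (if p ∈ J then -1 else 1)) +
          (1 - h p) * ((if p ∈ I then g p else 1) * (if p ∈ J then g p else 1))) := by
        rw [Finset.sum_comm]
        refine Finset.sum_congr rfl fun I _ => ?_
        rw [Finset.sum_comm]
        refine Finset.sum_congr rfl fun J _ => ?_
        rw [← sum_powerset_bernoulli]
    _ = ∑ I ∈ 𝒬, ∑ J ∈ 𝒬, if I = J then ∏ p ∈ I, g p else 0 := by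
        refine Finset.sum_congr rfl fun I hI => Finset.sum_congr rfl fun J hJ => ?_
        split_ifs with hIJ
        · subst hIJ
          rw [prod_subset_eq_prod_ite (h𝒬P I hI)]
          refine Finset.prod_congr rfl fun p hp => ?_
          have := hg p hp
          split_ifs
          · linear_combination g p * this - this
          · ring
        · obtain ⟨p, hp⟩ : ∃ p, ¬ (p ∈ I ↔ p ∈ J) := by
            by_contra hcon
            push Not at hcon
            exact hIJ (Finset.ext hcon)
          have hpP : p ∈ P := by
            by_cases hpI : p ∈ I
            · exact h𝒬P I hI hpI
            · exact h𝒬P J hJ (by tauto)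
          refine Finset.prod_eq_zero hpP ?_
          have := hg p hpP
          by_cases hpI : p ∈ I <;> by_cases hpJ : p ∈ J
          · tauto
          · simp only [hpI, hpJ, if_true, if_false]
            linear_combination this
          · simp only [hpI, hpJ, if_true, if_false]
            linear_combination this
          · tauto
    _ = _ := by
        refine Finset.sum_congr rfl fun I hI => ?_
        rw [Finset.sum_ite_eq, if_pos hI]

/-- Selberg's upper bound sieve, over a downward closed family of sets of primes. -/
theorem selberg_sieve {α : Type*} {P : Finset ι} {𝒬 : Finset (Finset ι)}
    (h𝒬 : ∀ I ∈ 𝒬, ∀ J ⊆ I, J ∈ 𝒬) (h𝒬P : ∀ I ∈ 𝒬, I ⊆ P) {h g : ι → ℝ}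
    (hg : ∀ p ∈ P, (1 - h p) * g p = h p) (hg0 : ∀ p ∈ P, 0 ≤ g p)
    (S B : Finset α) (hBS : B ⊆ S) (X : α → Finset ι) (hB : ∀ b ∈ B, Disjoint (X b) P)
    {R : Finset ι → ℝ}
    (hR : ∀ D ⊆ P, |(({s ∈ S | D ⊆ X s}).card : ℝ) - S.card * ∏ p ∈ D, h p| ≤ R D) :
    (B.card : ℝ) * ∑ I ∈ 𝒬, ∏ p ∈ I, g p ≤
      S.card + (∑ I ∈ 𝒬, ∏ p ∈ I, g p) * ∑ D ∈ 𝒬, ∑ E ∈ 𝒬, R (D ∪ E) := by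
  set L := ∑ I ∈ 𝒬, ∏ p ∈ I, g p with hL
  have hL0 : 0 ≤ L := Finset.sum_nonneg fun I hI => Finset.prod_nonneg fun p hp =>
    hg0 p (h𝒬P I hI hp)
  have hform : ∀ b ∈ B, selbergForm 𝒬 g (X b) = L := by
    intro b hb
    rw [selbergForm, hL]
    refine Finset.sum_congr rfl fun I hI => Finset.prod_congr rfl fun p hp => ?_
    rw [if_neg]
    exact fun hpX => Finset.disjoint_left.mp (hB b hb) hpX (h𝒬P I hI hp)
  have hlow : (B.card : ℝ) * L ^ 2 ≤ ∑ s ∈ S, selbergForm 𝒬 g (X s) ^ 2 := by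
    calc _ = ∑ b ∈ B, selbergForm 𝒬 g (X b) ^ 2 := by
          rw [← nsmul_eq_mul, ← Finset.sum_const]
          exact Finset.sum_congr rfl fun b hb => by rw [hform b hb]
      _ ≤ _ := Finset.sum_le_sum_of_subset_of_nonneg hBS fun _ _ _ => sq_nonneg _
  have hup : ∑ s ∈ S, selbergForm 𝒬 g (X s) ^ 2 ≤
      S.card * L + L ^ 2 * ∑ D ∈ 𝒬, ∑ E ∈ 𝒬, R (D ∪ E) := by
    calc _ = ∑ D ∈ 𝒬, ∑ E ∈ 𝒬, selbergCoeff 𝒬 g D * selbergCoeff 𝒬 g E *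
          (({s ∈ S | D ∪ E ⊆ X s}).card : ℝ) := by
          simp_rw [selbergForm_eq_sum_coeff h𝒬, sq, Finset.sum_mul_sum]
          rw [Finset.sum_comm]
          refine Finset.sum_congr rfl fun D _ => ?_
          rw [Finset.sum_comm]
          refine Finset.sum_congr rfl fun E _ => ?_
          rw [Finset.card_filter, Nat.cast_sum, Finset.mul_sum]
          refine Finset.sum_congr rfl fun s _ => ?_
          by_cases hDX : D ⊆ X s <;> by_cases hEX : E ⊆ X s <;>
            simp [Finset.union_subset_iff, hDX, hEX]
      _ ≤ ∑ D ∈ 𝒬, ∑ E ∈ 𝒬, (S.card * (selbergCoeff 𝒬 g D * selbergCoeff 𝒬 g E *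
          ∏ p ∈ D ∪ E, h p) + L ^ 2 * R (D ∪ E)) := by
          refine Finset.sum_le_sum fun D hD => Finset.sum_le_sum fun E hE => ?_
          have h1 := hR (D ∪ E) (Finset.union_subset (h𝒬P D hD) (h𝒬P E hE))
          have hgQ : ∀ I ∈ 𝒬, ∀ p ∈ I, 0 ≤ g p := fun I hI p hp => hg0 p (h𝒬P I hI hp)
          have h2 : |selbergCoeff 𝒬 g D * selbergCoeff 𝒬 g E| ≤ L ^ 2 := by
            rw [abs_mul, sq]
            exact mul_le_mul (abs_selbergCoeff_le h𝒬 hgQ hD) (abs_selbergCoeff_le h𝒬 hgQ hE)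
              (abs_nonneg _) hL0
          have h3 := mul_le_mul h2 h1 (abs_nonneg _) (by positivity)
          rw [← abs_mul] at h3
          have h4 := (le_abs_self _).trans h3
          rw [mul_sub] at h4
          linarith
      _ = _ := by
          simp_rw [Finset.sum_add_distrib, ← Finset.mul_sum]
          rw [sum_sum_selbergCoeff_mul h𝒬 h𝒬P hg]
  rcases hL0.eq_or_lt with h0 | hpos
  · rw [← h0]
    simp
  · refine le_of_mul_le_mul_right (le_trans (le_of_eq ?_) (hlow.trans (hup.trans (le_of_eq ?_)))) hpos
    · ring
    · ring

end SelbergSieve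

lemma totient_prod_primes {D : Finset ℕ} (hD : ∀ p ∈ D, p.Prime) :
    ((∏ p ∈ D, p).totient : ℝ) = ∏ p ∈ D, ((p : ℝ) - 1) := by
  induction D using Finset.induction_on with
  | empty => simp
  | insert q D hq ih =>
    have hqp := hD q (Finset.mem_insert_self _ _)
    have hD' : ∀ p ∈ D, p.Prime := fun p hp => hD p (Finset.mem_insert_of_mem hp)
    rw [Finset.prod_insert hq, Finset.prod_insert hq, Nat.totient_mul, Nat.cast_mul, ih hD',
      Nat.totient_prime hqp, Nat.cast_sub hqp.one_le, Nat.cast_one]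
    refine Nat.Coprime.prod_right fun p hp => ?_
    exact (Nat.coprime_primes hqp (hD' p hp)).mpr fun h => hq (h ▸ hp)

/-- The number of `s ∈ S` lying in given sets of reduced classes modulo each prime of `D`. -/
lemma abs_card_filter_sub_le_maxDiscrepancy {D : Finset ℕ} (hD : ∀ p ∈ D, p.Prime)
    (Ω : (p : ℕ) → Finset (ZMod p)) (hΩ : ∀ p ∈ D, (0 : ZMod p) ∉ Ω p) (S : Finset ℕ) :
    |(({s ∈ S | ∀ p ∈ D, (s : ZMod p) ∈ Ω p}).card : ℝ) -
      S.card * ∏ p ∈ D, (((Ω p).card : ℝ) / ((p : ℝ) - 1))| ≤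
      (∏ p ∈ D, ((Ω p).card : ℝ)) * maxDiscrepancy S (∏ p ∈ D, p) := by
  classical
  set d := ∏ p ∈ D, p with hd
  have hd0 : d ≠ 0 := Finset.prod_ne_zero_iff.mpr fun p hp => (hD p hp).ne_zero
  have : NeZero d := ⟨hd0⟩
  have hcount : ({s ∈ S | ∀ p ∈ D, (s : ZMod p) ∈ Ω p}).card =
      ∑ t ∈ D.pi Ω, ({s ∈ S | ∀ p (hp : p ∈ D), (s : ZMod p) = t p hp}).card := by
    rw [Finset.card_eq_sum_card_fiberwise (f := fun s p (_ : p ∈ D) => (s : ZMod p)) (t := D.pi Ω)]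
    · refine Finset.sum_congr rfl fun t ht => ?_
      congr 1
      ext s
      simp only [Finset.mem_filter, and_assoc]
      refine and_congr_right fun _ => ⟨fun h p hp => ?_, fun h => ⟨fun p hp => ?_, ?_⟩⟩
      · rw [← h.2]
      · rw [h p hp]
        exact Finset.mem_pi.mp ht p hp
      · funext p hp
        exact h p hp
    · intro s hs
      simp only [Finset.coe_filter, Set.mem_ofPred_eq] at hs
      exact Finset.mem_coe.mpr (Finset.mem_pi.mpr hs.2)
  have hbdd : BddAbove (Set.range fun a : (ZMod d)ˣ =>
      |((S.filter (fun s : ℕ => (s : ZMod d) = (a : ZMod d))).card : ℝ)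
        - (S.card : ℝ) / (d.totient : ℝ)|) := Set.Finite.bddAbove (Set.finite_range _)
  have hterm : ∀ t ∈ D.pi Ω,
      |(({s ∈ S | ∀ p (hp : p ∈ D), (s : ZMod p) = t p hp}).card : ℝ) -
        S.card / (d.totient : ℝ)| ≤ maxDiscrepancy S d := by
    intro t ht
    set r : ℕ → ℕ := fun p => if h : p ∈ D then (t p h).val else 0 with hr
    obtain ⟨k, hk⟩ := Nat.chineseRemainderOfFinset r id D (fun p hp => (hD p hp).ne_zero)
      (fun p hp q hq hpq => (Nat.coprime_primes (hD p hp) (hD q hq)).mpr hpq)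
    have hkp : ∀ p (hp : p ∈ D), (k : ZMod p) = t p hp := by
      intro p hp
      have : NeZero p := ⟨(hD p hp).ne_zero⟩
      have h1 := (ZMod.natCast_eq_natCast_iff _ _ _).mpr (hk p hp)
      rw [id, hr] at h1
      simp only [hp, dif_pos] at h1
      rw [h1, ZMod.natCast_zmod_val]
    have hcop : k.Coprime d := by
      refine Nat.Coprime.prod_right fun p hp => ?_
      refine Nat.Coprime.symm (((hD p hp).coprime_iff_not_dvd).mpr fun hdvd => ?_)
      have h0 := (ZMod.natCast_eq_zero_iff k p).mpr hdvd
      rw [hkp p hp] at h0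
      exact hΩ p hp (h0 ▸ Finset.mem_pi.mp ht p hp)
    have hiff : ∀ s : ℕ, (∀ p (hp : p ∈ D), (s : ZMod p) = t p hp) ↔ (s : ZMod d) = (k : ZMod d) := by
      intro s
      constructor
      · intro h
        rw [ZMod.natCast_eq_natCast_iff, Nat.modEq_iff_dvd]
        have : ((d : ℕ) : ℤ) = ∏ p ∈ D, (p : ℤ) := by rw [hd]; push_cast; rfl
        rw [this]
        refine Finset.prod_dvd_of_coprime (fun p hp q hq hpq => ?_) fun p hp => ?_
        · exact Nat.isCoprime_iff_coprime.mpr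
            ((Nat.coprime_primes (hD p hp) (hD q hq)).mpr hpq)
        · rw [← Nat.modEq_iff_dvd, ← ZMod.natCast_eq_natCast_iff, h p hp, hkp p hp]
      · intro h p hp
        rw [← hkp p hp, ZMod.natCast_eq_natCast_iff]
        rw [ZMod.natCast_eq_natCast_iff] at h
        exact h.of_dvd (Finset.dvd_prod_of_mem _ hp)
    refine le_trans (le_of_eq ?_) (le_ciSup hbdd (ZMod.unitOfCoprime k hcop))
    simp only [ZMod.coe_unitOfCoprime, hiff]
    congr!
  have hmain : (S.card : ℝ) * ∏ p ∈ D, (((Ω p).card : ℝ) / ((p : ℝ) - 1)) =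
      ∑ t ∈ D.pi Ω, (S.card : ℝ) / (d.totient : ℝ) := by
    rw [Finset.sum_const, Finset.card_pi, nsmul_eq_mul, Finset.prod_div_distrib, hd,
      totient_prod_primes hD]
    push_cast
    ring
  rw [hmain, hcount, Nat.cast_sum, ← Finset.sum_sub_distrib]
  refine (Finset.abs_sum_le_sum_abs _ _).trans ((Finset.sum_le_sum hterm).trans (le_of_eq ?_))
  rw [Finset.sum_const, Finset.card_pi, nsmul_eq_mul]
  push_cast
  rfl

lemma maxDiscrepancy_nonneg (S : Finset ℕ) (d : ℕ) : 0 ≤ maxDiscrepancy S d :=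
  Real.iSup_nonneg fun _ => abs_nonneg _

lemma sum_log_primes_dvd_le {T : Finset ℕ} (hT : ∀ p ∈ T, p.Prime) {m : ℕ} (hm : m ≠ 0) :
    ∑ p ∈ T with p ∣ m, Real.log p ≤ Real.log m := by
  have hdvd : ∏ p ∈ T with p ∣ m, p ∣ m :=
    Finset.prod_primes_dvd m (fun p hp => (hT p (Finset.mem_filter.mp hp).1).prime)
      fun p hp => (Finset.mem_filter.mp hp).2
  rw [← Real.log_prod fun p hp =>
    Nat.cast_ne_zero.mpr (hT p (Finset.mem_filter.mp hp).1).ne_zero]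
  refine Real.log_le_log (Finset.prod_pos fun p hp => ?_) ?_
  · exact_mod_cast (hT p (Finset.mem_filter.mp hp).1).pos
  · rw [← Nat.cast_prod]
    exact_mod_cast Nat.le_of_dvd (Nat.pos_of_ne_zero hm) hdvd

lemma sum_log_primes_modEq_le {T : Finset ℕ} (hT : ∀ p ∈ T, p.Prime) {x : ℝ} {a b : ℕ}
    (ha : (a : ℝ) ≤ x) (hb : (b : ℝ) ≤ x) (hab : a ≠ b) :
    ∑ p ∈ T with (a : ZMod p) = (b : ZMod p), Real.log p ≤ Real.log x := by
  wlog hlt : a < b generalizing a b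
  · have := this hb ha hab.symm (by omega)
    simpa only [eq_comm] using this
  have hne : b - a ≠ 0 := by omega
  have heq : ∀ p : ℕ, ((a : ZMod p) = (b : ZMod p)) ↔ p ∣ b - a := by
    intro p
    rw [ZMod.natCast_eq_natCast_iff, Nat.modEq_iff_dvd' hlt.le]
  simp_rw [heq]
  refine (sum_log_primes_dvd_le hT hne).trans (Real.log_le_log ?_ ?_)
  · exact_mod_cast Nat.pos_of_ne_zero hne
  · exact le_trans (by exact_mod_cast Nat.sub_le b a) hb

/-- The number of residue classes modulo `p` occupied by `A`. -/
def residueCount (A : Finset ℕ) (p : ℕ) : ℕ := (A.image fun a : ℕ => (a : ZMod p)).card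

lemma residueCount_pos {A : Finset ℕ} (hA : A.Nonempty) (p : ℕ) : 0 < residueCount A p :=
  Finset.card_pos.mpr (hA.image _)

lemma card_sq_le_residueCount_mul (A : Finset ℕ) (p : ℕ) :
    (A.card : ℝ) ^ 2 ≤ residueCount A p *
      ∑ a ∈ A, ∑ b ∈ A, if (a : ZMod p) = (b : ZMod p) then (1 : ℝ) else 0 := by
  set V := A.image fun a : ℕ => (a : ZMod p) with hV
  set N : ZMod p → ℝ := fun v => ∑ a ∈ A, if (a : ZMod p) = v then (1 : ℝ) else 0 with hN
  have h1 : (A.card : ℝ) = ∑ v ∈ V, N v := by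
    simp only [hN]
    rw [Finset.sum_comm]
    simp_rw [Finset.sum_ite_eq]
    rw [Finset.sum_congr rfl fun a ha => if_pos (Finset.mem_image_of_mem _ ha)]
    simp
  have h2 : ∑ v ∈ V, N v ^ 2 =
      ∑ a ∈ A, ∑ b ∈ A, if (a : ZMod p) = (b : ZMod p) then (1 : ℝ) else 0 := by
    simp only [hN, sq, Finset.sum_mul_sum]
    rw [Finset.sum_comm]
    refine Finset.sum_congr rfl fun a ha => ?_
    rw [Finset.sum_comm]
    refine Finset.sum_congr rfl fun b _ => ?_
    rw [Finset.sum_eq_single (a : ZMod p)]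
    · simp [eq_comm]
    · intro v _ hv
      rw [if_neg (Ne.symm hv), zero_mul]
    · exact fun h => absurd (Finset.mem_image_of_mem _ ha) h
  rw [h1, ← h2]
  exact sq_sum_le_card_mul_sum_sq

/-- Gallagher's larger sieve. -/
theorem larger_sieve {T : Finset ℕ} (hT : ∀ p ∈ T, p.Prime) {A : Finset ℕ} (hA : A.Nonempty)
    {x : ℝ} (hx : 1 ≤ x) (hAx : ∀ a ∈ A, (a : ℝ) ≤ x) :
    ∑ p ∈ T, Real.log p / residueCount A p ≤
      (∑ p ∈ T, Real.log p) / A.card + Real.log x := by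
  have hcard : (0 : ℝ) < A.card := by exact_mod_cast hA.card_pos
  have hlog : ∀ p ∈ T, 0 ≤ Real.log p := fun p hp =>
    Real.log_nonneg (by exact_mod_cast (hT p hp).one_le)
  have h1 : ∀ p ∈ T, (A.card : ℝ) ^ 2 * (Real.log p / residueCount A p) ≤
      Real.log p * ∑ a ∈ A, ∑ b ∈ A, if (a : ZMod p) = (b : ZMod p) then (1 : ℝ) else 0 := by
    intro p hp
    have hν : (0 : ℝ) < residueCount A p := by exact_mod_cast residueCount_pos hA p
    rw [← mul_div_assoc, div_le_iff₀ hν]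
    nlinarith [mul_le_mul_of_nonneg_left (card_sq_le_residueCount_mul A p) (hlog p hp)]
  have h2 : (A.card : ℝ) ^ 2 * ∑ p ∈ T, Real.log p / residueCount A p ≤
      A.card * (∑ p ∈ T, Real.log p) + (A.card : ℝ) ^ 2 * Real.log x := by
    rw [Finset.mul_sum]
    refine (Finset.sum_le_sum h1).trans ?_
    have hswap : ∑ p ∈ T, Real.log p *
        ∑ a ∈ A, ∑ b ∈ A, (if (a : ZMod p) = (b : ZMod p) then (1 : ℝ) else 0) =
        ∑ a ∈ A, ∑ b ∈ A, ∑ p ∈ T with (a : ZMod p) = (b : ZMod p), Real.log p := by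
      simp_rw [Finset.mul_sum]
      rw [Finset.sum_comm]
      refine Finset.sum_congr rfl fun a _ => ?_
      rw [Finset.sum_comm]
      refine Finset.sum_congr rfl fun b _ => ?_
      rw [Finset.sum_filter]
      exact Finset.sum_congr rfl fun p _ => by simp
    rw [hswap]
    have hab : ∀ a ∈ A, ∀ b ∈ A, ∑ p ∈ T with (a : ZMod p) = (b : ZMod p), Real.log p ≤
        (if a = b then ∑ p ∈ T, Real.log p else 0) + Real.log x := by
      intro a ha b hb
      split_ifs with h
      · subst h
        simpa using Real.log_nonneg hx
      · rw [zero_add]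
        exact sum_log_primes_modEq_le hT (hAx a ha) (hAx b hb) h
    refine (Finset.sum_le_sum fun a ha => Finset.sum_le_sum fun b hb => hab a ha b hb).trans
      (le_of_eq ?_)
    simp_rw [Finset.sum_add_distrib, Finset.sum_ite_eq]
    rw [Finset.sum_congr rfl fun a ha => if_pos ha]
    simp only [Finset.sum_const, nsmul_eq_mul]
    ring
  have h3 : (A.card : ℝ) ^ 2 * ((∑ p ∈ T, Real.log p) / A.card + Real.log x) =
      A.card * (∑ p ∈ T, Real.log p) + (A.card : ℝ) ^ 2 * Real.log x := by
    field_simp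
  rw [← h3] at h2
  exact le_of_mul_le_mul_left h2 (by positivity)

/-- The subsets of `P` with product at most `Q`. -/
noncomputable def boundedSubsets (P : Finset ℕ) (Q : ℝ) : Finset (Finset ℕ) :=
  by classical exact {I ∈ P.powerset | ((∏ p ∈ I, p : ℕ) : ℝ) ≤ Q}

lemma mem_boundedSubsets {P : Finset ℕ} {Q : ℝ} {I : Finset ℕ} :
    I ∈ boundedSubsets P Q ↔ I ⊆ P ∧ ((∏ p ∈ I, p : ℕ) : ℝ) ≤ Q := by
  simp [boundedSubsets]

lemma prod_le_prod_of_subset_primes {I J : Finset ℕ} (hI : ∀ p ∈ I, p.Prime) (hJ : J ⊆ I) :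
    ∏ p ∈ J, p ≤ ∏ p ∈ I, p :=
  Finset.prod_le_prod_of_subset_of_one_le' hJ fun p hp _ => (hI p hp).one_le

lemma boundedSubsets_down {P : Finset ℕ} (hP : ∀ p ∈ P, p.Prime) {Q : ℝ} :
    ∀ I ∈ boundedSubsets P Q, ∀ J ⊆ I, J ∈ boundedSubsets P Q := by
  intro I hI J hJ
  rw [mem_boundedSubsets] at *
  refine ⟨hJ.trans hI.1, le_trans ?_ hI.2⟩
  exact_mod_cast prod_le_prod_of_subset_primes (fun p hp => hP p (hI.1 hp)) hJ

lemma empty_mem_boundedSubsets {P : Finset ℕ} {Q : ℝ} (hQ : 1 ≤ Q) : ∅ ∈ boundedSubsets P Q := by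
  rw [mem_boundedSubsets]
  simpa using hQ

lemma sum_boundedSubsets_le_mul {P bad : Finset ℕ} (hP : ∀ p ∈ P, p.Prime) {Q : ℝ} {w : ℕ → ℝ}
    (hw : ∀ p ∈ P, 0 ≤ w p) (hbad : bad ⊆ P) :
    ∑ I ∈ boundedSubsets P Q, ∏ p ∈ I, w p ≤
      (∏ p ∈ bad, (1 + w p)) * ∑ I ∈ boundedSubsets (P \ bad) Q, ∏ p ∈ I, w p := by
  classical
  rw [Finset.prod_one_add, Finset.sum_mul_sum, ← Finset.sum_product']
  set φ : Finset ℕ → Finset ℕ × Finset ℕ := fun I => (I ∩ bad, I \ bad) with hφ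
  have hinj : Function.Injective φ := by
    intro I J hIJ
    simp only [hφ, Prod.mk.injEq] at hIJ
    rw [← Finset.sdiff_union_inter I bad, hIJ.1, hIJ.2, Finset.sdiff_union_inter]
  calc _ = ∑ I ∈ boundedSubsets P Q, (∏ p ∈ (φ I).1, w p) * ∏ p ∈ (φ I).2, w p := by
        refine Finset.sum_congr rfl fun I _ => ?_
        rw [← Finset.prod_inter_mul_prod_sdiff I bad w]
    _ = ∑ a ∈ (boundedSubsets P Q).image φ, (∏ p ∈ a.1, w p) * ∏ p ∈ a.2, w p :=
        (Finset.sum_image (f := fun a : Finset ℕ × Finset ℕ =>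
          (∏ p ∈ a.1, w p) * ∏ p ∈ a.2, w p) hinj.injOn).symm
    _ ≤ _ := by
        refine Finset.sum_le_sum_of_subset_of_nonneg (Finset.image_subset_iff.mpr fun I hI => ?_) ?_
        · have h1 := mem_boundedSubsets.mp (boundedSubsets_down hP I hI _
            (Finset.sdiff_subset (t := bad)))
          rw [mem_boundedSubsets] at hI
          simp only [hφ, Finset.mem_product, Finset.mem_powerset, mem_boundedSubsets]
          exact ⟨Finset.inter_subset_right, Finset.sdiff_subset_sdiff hI.1 le_rfl, h1.2⟩
        · intro a ha _
          simp only [Finset.mem_product, Finset.mem_powerset, mem_boundedSubsets] at ha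
          refine mul_nonneg (Finset.prod_nonneg fun p hp => hw p (hbad (ha.1 hp)))
            (Finset.prod_nonneg fun p hp => hw p (Finset.mem_sdiff.mp (ha.2.1 hp)).1)

lemma one_add_sum_moebius_sq_le {P : Finset ℕ} {N : ℕ} {Pset : Set ℕ}
    (hPmem : ∀ p : ℕ, p.Prime → p ∈ Pset → p ≤ N → p ∈ P) {Q : ℝ} (hQ : 1 ≤ Q)
    (hNQ : (N : ℝ) ≤ Q) {w : ℕ → ℝ} (hw : ∀ p ∈ P, 0 ≤ w p) {s : Finset ℕ}
    (hs : ∀ q ∈ s, 1 < q ∧ q ≤ N ∧ PrimeDivisorsIn Pset q) :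
    1 + ∑ q ∈ s, (ArithmeticFunction.moebius q : ℝ) ^ 2 * ∏ p ∈ q.primeFactors, w p ≤
      ∑ I ∈ boundedSubsets P Q, ∏ p ∈ I, w p := by
  classical
  set s' := s.filter Squarefree with hs'
  have h1 : ∑ q ∈ s, (ArithmeticFunction.moebius q : ℝ) ^ 2 * ∏ p ∈ q.primeFactors, w p =
      ∑ q ∈ s', ∏ p ∈ q.primeFactors, w p := by
    rw [hs', Finset.sum_filter]
    refine Finset.sum_congr rfl fun q _ => ?_
    split_ifs with hq
    · have h2 : ArithmeticFunction.moebius q ^ 2 = 1 :=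
        ArithmeticFunction.moebius_sq_eq_one_of_squarefree hq
      have h3 : (ArithmeticFunction.moebius q : ℝ) ^ 2 = 1 := by exact_mod_cast h2
      rw [h3, one_mul]
    · rw [ArithmeticFunction.moebius_eq_zero_of_not_squarefree hq]
      simp
  have hinj : Set.InjOn Nat.primeFactors (s' : Set ℕ) := by
    intro a ha b hb hab
    rw [← Nat.prod_primeFactors_of_squarefree (Finset.mem_filter.mp (Finset.mem_coe.mp ha)).2,
      ← Nat.prod_primeFactors_of_squarefree (Finset.mem_filter.mp (Finset.mem_coe.mp hb)).2, hab]
  have hsub : s'.image Nat.primeFactors ⊆ (boundedSubsets P Q).erase ∅ := by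
    refine Finset.image_subset_iff.mpr fun q hq => ?_
    obtain ⟨hqs, hsq⟩ := Finset.mem_filter.mp hq
    obtain ⟨hq1, hqN, hqP⟩ := hs q hqs
    rw [Finset.mem_erase, mem_boundedSubsets]
    refine ⟨?_, fun p hp => ?_, ?_⟩
    · rw [← Finset.nonempty_iff_ne_empty, Nat.nonempty_primeFactors]
      exact hq1
    · have hp' := Nat.prime_of_mem_primeFactors hp
      have hdvd := Nat.dvd_of_mem_primeFactors hp
      exact hPmem p hp' (hqP p hp' hdvd) ((Nat.le_of_dvd (by omega) hdvd).trans hqN)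
    · rw [Nat.prod_primeFactors_of_squarefree hsq]
      exact le_trans (by exact_mod_cast hqN) hNQ
  rw [h1, ← Finset.add_sum_erase _ _ (empty_mem_boundedSubsets hQ), Finset.prod_empty]
  gcongr
  rw [← Finset.sum_image (f := fun I => ∏ p ∈ I, w p) hinj]
  refine Finset.sum_le_sum_of_subset_of_nonneg hsub fun I hI _ => Finset.prod_nonneg fun p hp => ?_
  exact hw p ((mem_boundedSubsets.mp (Finset.mem_of_mem_erase hI)).1 hp)

/-- The primes of `P` dividing a difference of distinct elements of `A`. -/
def differencePrimes (P A : Finset ℕ) : Finset ℕ :=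
  {p ∈ P | ∃ a ∈ A, ∃ b ∈ A, a ≠ b ∧ (a : ZMod p) = (b : ZMod p)}

lemma prod_differencePrimes_le {P A : Finset ℕ} (hP : ∀ p ∈ P, p.Prime) {K x : ℝ}
    (hK : 1000 * Real.log x ≤ K) (hx : 1 ≤ Real.log x) (hPK : ∀ p ∈ P, K ^ 3 ≤ (p : ℝ))
    (hAK : (A.card : ℝ) ≤ K) (hAx : ∀ a ∈ A, (a : ℝ) ≤ x) {w : ℕ → ℝ}
    (hw0 : ∀ p ∈ P, 0 ≤ w p) (hw : ∀ p ∈ P, w p ≤ 2 / p) :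
    ∏ p ∈ differencePrimes P A, (1 + w p) ≤ 101 / 100 := by
  classical
  have hK1000 : 1000 ≤ K := by linarith
  have hbad : ((differencePrimes P A).card : ℝ) ≤ K ^ 2 * Real.log x := by
    have hlog1 : ∀ p ∈ P, 1 ≤ Real.log p := by
      intro p hp
      rw [Real.le_log_iff_exp_le (by exact_mod_cast (hP p hp).pos)]
      have := hPK p hp
      have h3 : K ≤ K ^ 3 := by nlinarith [sq_nonneg K]
      linarith [Real.exp_one_lt_d9]
    have hsub : differencePrimes P A ⊆
        A.offDiag.biUnion fun ab => {p ∈ P | (ab.1 : ZMod p) = (ab.2 : ZMod p)} := by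
      intro p hp
      simp only [differencePrimes, Finset.mem_filter] at hp
      obtain ⟨hpP, a, ha, b, hb, hab, hmod⟩ := hp
      simp only [Finset.mem_biUnion, Finset.mem_offDiag, Finset.mem_filter]
      exact ⟨(a, b), ⟨ha, hb, hab⟩, hpP, hmod⟩
    calc ((differencePrimes P A).card : ℝ)
        ≤ ∑ ab ∈ A.offDiag, (({p ∈ P | (ab.1 : ZMod p) = (ab.2 : ZMod p)}).card : ℝ) := by
          exact_mod_cast (Finset.card_le_card hsub).trans Finset.card_biUnion_le
      _ ≤ ∑ ab ∈ A.offDiag, Real.log x := by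
          refine Finset.sum_le_sum fun ab hab => ?_
          rw [Finset.mem_offDiag] at hab
          refine le_trans ?_ (sum_log_primes_modEq_le hP (hAx _ hab.1) (hAx _ hab.2.1) hab.2.2)
          rw [Finset.card_eq_sum_ones]
          push_cast
          exact Finset.sum_le_sum fun p hp => hlog1 p (Finset.mem_filter.mp hp).1
      _ = (A.offDiag.card : ℝ) * Real.log x := by rw [Finset.sum_const, nsmul_eq_mul]
      _ ≤ K ^ 2 * Real.log x := by
          refine mul_le_mul_of_nonneg_right ?_ (by linarith)
          have h1 : (A.offDiag.card : ℝ) ≤ (A.card : ℝ) * A.card := by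
            rw [Finset.offDiag_card]
            exact_mod_cast Nat.sub_le _ _
          nlinarith [(Nat.cast_nonneg A.card : (0 : ℝ) ≤ A.card)]
  have hbadP : differencePrimes P A ⊆ P := Finset.filter_subset _ _
  have hsum : ∑ p ∈ differencePrimes P A, w p ≤ 1 / 500 := by
    calc _ ≤ ∑ p ∈ differencePrimes P A, 2 / K ^ 3 := by
          refine Finset.sum_le_sum fun p hp => (hw p (hbadP hp)).trans ?_
          exact div_le_div_of_nonneg_left (by norm_num) (by positivity) (hPK p (hbadP hp))
      _ = (differencePrimes P A).card * (2 / K ^ 3) := by rw [Finset.sum_const, nsmul_eq_mul]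
      _ ≤ K ^ 2 * Real.log x * (2 / K ^ 3) :=
          mul_le_mul_of_nonneg_right hbad (by positivity)
      _ = 2 * Real.log x / K := by
          have : K ≠ 0 := by linarith
          field_simp
      _ ≤ 1 / 500 := by
          rw [div_le_div_iff₀ (by linarith) (by norm_num)]
          linarith
  calc _ ≤ ∏ p ∈ differencePrimes P A, Real.exp (w p) := by
        refine Finset.prod_le_prod (fun p hp => ?_) fun p _ => ?_
        · linarith [hw0 p (hbadP hp)]
        · linarith [Real.add_one_le_exp (w p)]
    _ = Real.exp (∑ p ∈ differencePrimes P A, w p) := (Real.exp_sum _ _).symm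
    _ ≤ Real.exp (1 / 500) := Real.exp_le_exp.mpr hsum
    _ ≤ 101 / 100 := by
        have h1 := Real.one_sub_le_exp_neg (1 / 500)
        rw [Real.exp_neg] at h1
        have h2 := inv_anti₀ (by norm_num) h1
        rw [inv_inv] at h2
        exact h2.trans (by norm_num)

/-- A lower bound for the sieve sum over the primes not dividing differences of `A`. -/
lemma sieve_sum_lower_bound {P A : Finset ℕ} (hP : ∀ p ∈ P, p.Prime) {K x Q Z k : ℝ}
    (hK : 1000 * Real.log x ≤ K) (hx : 1 ≤ Real.log x) (hPK : ∀ p ∈ P, K ^ 3 ≤ (p : ℝ))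
    (hAK : (A.card : ℝ) ≤ K) (hAx : ∀ a ∈ A, (a : ℝ) ≤ x) {w g : ℕ → ℝ}
    (hw0 : ∀ p ∈ P, 0 ≤ w p) (hw : ∀ p ∈ P, w p ≤ 2 / p) (hQ : 1 ≤ Q) (hZ : 10 ≤ Z)
    (hk : 1 ≤ k) (hsum : 1 + Z ≤ ∑ I ∈ boundedSubsets P Q, ∏ p ∈ I, w p)
    (hg : ∀ p ∈ P \ differencePrimes P A, k * w p ≤ g p) :
    98 / 100 * (k * Z) ≤ ∑ I ∈ boundedSubsets (P \ differencePrimes P A) Q, ∏ p ∈ I, g p := by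
  classical
  set G := P \ differencePrimes P A with hG
  have hGP : G ⊆ P := Finset.sdiff_subset
  have h1 := sum_boundedSubsets_le_mul hP (Q := Q) hw0 (bad := differencePrimes P A)
    (Finset.filter_subset _ _)
  have h2 := prod_differencePrimes_le hP hK hx hPK hAK hAx hw0 hw
  rw [← hG] at h1
  have hmem : ∅ ∈ boundedSubsets G Q := empty_mem_boundedSubsets hQ
  have h3 : ∀ I ∈ (boundedSubsets G Q).erase ∅, k * ∏ p ∈ I, w p ≤ ∏ p ∈ I, g p := by
    intro I hI
    obtain ⟨hne, hIQ⟩ := Finset.mem_erase.mp hI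
    have hIG := (mem_boundedSubsets.mp hIQ).1
    have hcard : I.card ≠ 0 := Finset.card_ne_zero.mpr (Finset.nonempty_iff_ne_empty.mpr hne)
    calc k * ∏ p ∈ I, w p ≤ k ^ I.card * ∏ p ∈ I, w p := by
          refine mul_le_mul_of_nonneg_right (le_self_pow₀ hk hcard) ?_
          exact Finset.prod_nonneg fun p hp => hw0 p (hGP (hIG hp))
      _ = ∏ p ∈ I, k * w p := by rw [Finset.prod_mul_distrib, Finset.prod_const]
      _ ≤ _ := Finset.prod_le_prod
          (fun p hp => mul_nonneg (by linarith) (hw0 p (hGP (hIG hp)))) fun p hp => hg p (hIG hp)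
  set V := ∑ I ∈ boundedSubsets G Q, ∏ p ∈ I, w p with hV
  have hV0 : 0 ≤ V := Finset.sum_nonneg fun I hI => Finset.prod_nonneg fun p hp =>
    hw0 p (hGP ((mem_boundedSubsets.mp hI).1 hp))
  have h4 : 1 + Z ≤ 101 / 100 * V :=
    hsum.trans (h1.trans (mul_le_mul_of_nonneg_right h2 hV0))
  have h5 : V = 1 + ∑ I ∈ (boundedSubsets G Q).erase ∅, ∏ p ∈ I, w p := by
    rw [hV, ← Finset.add_sum_erase _ _ hmem, Finset.prod_empty]
  rw [← Finset.add_sum_erase _ _ hmem, Finset.prod_empty]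
  have h6 := Finset.sum_le_sum h3
  rw [← Finset.mul_sum] at h6
  have h7 : 98 / 100 * Z ≤ V - 1 := by linarith
  have h8 := mul_le_mul_of_nonneg_left h7 (by linarith : (0 : ℝ) ≤ k)
  have h9 : V - 1 = ∑ I ∈ (boundedSubsets G Q).erase ∅, ∏ p ∈ I, w p := by linarith
  rw [h9] at h8
  linarith

lemma card_pairs_union_eq_le {U : Finset ℕ} (s : Finset (Finset ℕ × Finset ℕ))
    (hs : ∀ a ∈ s, a.1 ∪ a.2 = U) : (s.card : ℝ) ≤ 3 ^ U.card := by
  classical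
  have h1 : s.card ≤ (U.powerset.sigma fun D => D.powerset).card := by
    refine Finset.card_le_card_of_injOn (fun a => ⟨a.1, a.1 ∩ a.2⟩) ?_ ?_
    · intro a ha
      have h := hs a ha
      simp only [Finset.coe_sigma, Set.mem_sigma_iff, Finset.mem_coe, Finset.mem_powerset]
      exact ⟨h ▸ Finset.subset_union_left, Finset.inter_subset_left⟩
    · intro a ha b hb hab
      have h1 := hs a ha
      have h2 := hs b hb
      simp only [Sigma.mk.injEq] at hab
      obtain ⟨h3, h4⟩ := hab
      have h4 := eq_of_heq h4
      refine Prod.ext h3 (Finset.ext fun p => ?_)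
      have e1 := Finset.ext_iff.mp h1 p
      have e2 := Finset.ext_iff.mp h2 p
      have e3 := Finset.ext_iff.mp h3 p
      have e4 := Finset.ext_iff.mp h4 p
      simp only [Finset.mem_union, Finset.mem_inter] at e1 e2 e4
      tauto
  have h2 : (U.powerset.sigma fun D => D.powerset).card = 3 ^ U.card := by
    rw [Finset.card_sigma]
    simp_rw [Finset.card_powerset]
    have h := Finset.sum_pow_mul_eq_add_pow (2 : ℕ) 1 U
    simpa using h
  exact_mod_cast h1.trans h2.le

lemma tau3_prod_primes {U : Finset ℕ} (hU : ∀ p ∈ U, p.Prime) :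
    tau3 (∏ p ∈ U, p) = 3 ^ U.card := by
  have hsq : Squarefree (∏ p ∈ U, p) :=
    Finset.squarefree_prod_of_pairwise_isCoprime
      (fun p hp q hq hpq => by
        exact Nat.coprime_iff_isRelPrime.mp
          ((Nat.coprime_primes (hU p hp) (hU q hq)).mpr hpq))
      fun p hp => (hU p hp).prime.squarefree
  rw [tau3, Nat.card_finMulAntidiag_of_squarefree hsq,
    ArithmeticFunction.cardDistinctFactors_apply, ← List.card_toFinset]
  change 3 ^ (∏ p ∈ U, p).primeFactors.card = _
  rw [Nat.primeFactors_prod hU]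

/-- Comparison of the error term of Selberg's sieve with a Bombieri–Vinogradov sum. -/
lemma sum_sum_error_le {P : Finset ℕ} (hP : ∀ p ∈ P, p.Prime) {Pset : Set ℕ}
    (hPset : ∀ p ∈ P, p ∈ Pset) {K k : ℝ} (hK : 1 ≤ K) (hk0 : 0 ≤ k) (hk : k ≤ K) (Q : ℕ)
    (S : Finset ℕ) {s : Finset ℕ}
    (hs : ∀ d, 1 ≤ d → d ≤ Q ^ 2 → PrimeDivisorsIn Pset d → d ∈ s) :
    ∑ D ∈ boundedSubsets P Q, ∑ E ∈ boundedSubsets P Q,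
      k ^ (D ∪ E).card * maxDiscrepancy S (∏ p ∈ D ∪ E, p) ≤
    ∑ d ∈ s, (ArithmeticFunction.moebius d : ℝ) ^ 2 *
      (tau3 d : ℝ) ^ (1 + Real.log K / Real.log 3) * maxDiscrepancy S d := by
  classical
  set V : Finset (Finset ℕ) := boundedSubsets P ((Q : ℝ) ^ 2) with hV
  have hVp : ∀ U ∈ V, ∀ p ∈ U, p.Prime := fun U hU p hp => hP p ((mem_boundedSubsets.mp hU).1 hp)
  rw [← Finset.sum_product']
  have hmaps : ∀ a ∈ boundedSubsets P Q ×ˢ boundedSubsets P Q, a.1 ∪ a.2 ∈ V := by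
    intro a ha
    obtain ⟨h1, h2⟩ := Finset.mem_product.mp ha
    rw [mem_boundedSubsets] at h1 h2
    rw [hV, mem_boundedSubsets]
    refine ⟨Finset.union_subset h1.1 h2.1, ?_⟩
    have hle : ∏ p ∈ a.1 ∪ a.2, p ≤ (∏ p ∈ a.1, p) * ∏ p ∈ a.2, p := by
      rw [← Finset.prod_union_inter]
      refine Nat.le_mul_of_pos_right _ (Finset.prod_pos fun p hp => ?_)
      exact (hP p (h1.1 (Finset.mem_inter.mp hp).1)).pos
    calc ((∏ p ∈ a.1 ∪ a.2, p : ℕ) : ℝ) ≤ ((∏ p ∈ a.1, p : ℕ) : ℝ) * ((∏ p ∈ a.2, p : ℕ) : ℝ) := by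
          exact_mod_cast hle
      _ ≤ Q * Q := mul_le_mul h1.2 h2.2 (by positivity) (by positivity)
      _ = (Q : ℝ) ^ 2 := by ring
  rw [← Finset.sum_fiberwise_of_maps_to hmaps]
  have hinj : Set.InjOn (fun U : Finset ℕ => ∏ p ∈ U, p) (V : Set (Finset ℕ)) := by
    intro U hU W hW hUW
    rw [← Nat.primeFactors_prod (hVp U hU), ← Nat.primeFactors_prod (hVp W hW)]
    exact congrArg Nat.primeFactors hUW
  have hterm : ∀ U ∈ V,
      ∑ a ∈ (boundedSubsets P Q ×ˢ boundedSubsets P Q) with a.1 ∪ a.2 = U,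
        k ^ (a.1 ∪ a.2).card * maxDiscrepancy S (∏ p ∈ a.1 ∪ a.2, p) ≤
      (ArithmeticFunction.moebius (∏ p ∈ U, p) : ℝ) ^ 2 *
      (tau3 (∏ p ∈ U, p) : ℝ) ^ (1 + Real.log K / Real.log 3) *
        maxDiscrepancy S (∏ p ∈ U, p) := by
    intro U hU
    have hsq : Squarefree (∏ p ∈ U, p) :=
      Finset.squarefree_prod_of_pairwise_isCoprime
        (fun p hp q hq hpq => by
          exact Nat.coprime_iff_isRelPrime.mp
            ((Nat.coprime_primes (hVp U hU p hp) (hVp U hU q hq)).mpr hpq))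
        fun p hp => (hVp U hU p hp).prime.squarefree
    have h2 : ArithmeticFunction.moebius (∏ p ∈ U, p) ^ 2 = 1 :=
      ArithmeticFunction.moebius_sq_eq_one_of_squarefree hsq
    have h3 : (ArithmeticFunction.moebius (∏ p ∈ U, p) : ℝ) ^ 2 = 1 := by exact_mod_cast h2
    have hpow : (tau3 (∏ p ∈ U, p) : ℝ) ^ (1 + Real.log K / Real.log 3) =
        3 ^ U.card * K ^ U.card := by
      rw [tau3_prod_primes (hVp U hU)]
      push_cast
      rw [← mul_pow, ← Real.rpow_natCast, ← Real.rpow_mul (by norm_num), mul_comm,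
        Real.rpow_mul (by norm_num), Real.rpow_natCast]
      congr 1
      rw [Real.rpow_add (by norm_num), Real.rpow_one]
      congr 1
      rw [Real.rpow_def_of_pos (by norm_num)]
      have : Real.log 3 ≠ 0 := (Real.log_pos (by norm_num)).ne'
      rw [mul_div_cancel₀ _ this, Real.exp_log (by linarith)]
    rw [h3, one_mul, hpow]
    rw [Finset.sum_congr rfl (g := fun _ => k ^ U.card * maxDiscrepancy S (∏ p ∈ U, p))
      fun a ha => by rw [(Finset.mem_filter.mp ha).2], Finset.sum_const, nsmul_eq_mul, ← mul_assoc]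
    refine mul_le_mul_of_nonneg_right ?_ (maxDiscrepancy_nonneg _ _)
    refine mul_le_mul (card_pairs_union_eq_le _ fun a ha => (Finset.mem_filter.mp ha).2)
      (pow_le_pow_left₀ hk0 hk _) (by positivity) (by positivity)
  refine (Finset.sum_le_sum hterm).trans ?_
  rw [← Finset.sum_image (f := fun d => (ArithmeticFunction.moebius d : ℝ) ^ 2 *
      (tau3 d : ℝ) ^ (1 + Real.log K / Real.log 3) * maxDiscrepancy S d) hinj]
  refine Finset.sum_le_sum_of_subset_of_nonneg (Finset.image_subset_iff.mpr fun U hU => ?_)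
    fun d _ _ => mul_nonneg (by positivity) (maxDiscrepancy_nonneg _ _)
  obtain ⟨hUP, hUQ⟩ := mem_boundedSubsets.mp hU
  refine hs _ (Nat.one_le_iff_ne_zero.mpr (Finset.prod_ne_zero_iff.mpr fun p hp =>
    (hVp U hU p hp).ne_zero)) (by exact_mod_cast hUQ) fun p hp hdvd => ?_
  obtain ⟨q, hq, hpq⟩ := (hp.prime.dvd_finsetProd_iff _).mp hdvd
  rw [(Nat.prime_dvd_prime_iff_eq hp (hVp U hU q hq)).mp hpq]
  exact hPset q (hUP hq)

/-- The large sieve bound for a subset of `[0, x]` and moduli up to `√x`. -/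
lemma card_mul_sieve_sum_le {P : Finset ℕ} (hP : ∀ p ∈ P, p.Prime)
    (Ω : (p : ℕ) → Finset (ZMod p)) (hΩ : ∀ p ∈ P, (Ω p).card < p)
    {𝒬 : Finset (Finset ℕ)} (h𝒬 : ∀ I ∈ 𝒬, I ⊆ P) {x : ℝ} (hx : 40 ≤ x)
    (hQI : ∀ I ∈ 𝒬, ((∏ p ∈ I, p : ℕ) : ℝ) ≤ Real.sqrt x) {B : Finset ℕ}
    (hB : ∀ b ∈ B, (b : ℝ) ≤ x) (hBΩ : ∀ b ∈ B, ∀ p ∈ P, (b : ZMod p) ∉ Ω p) :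
    B.card * ∑ I ∈ 𝒬, ∏ p ∈ I, sieveWeight p (Ω p) ≤ 41 / 10 * x := by
  set M := ⌈x / 2⌉₊ with hM
  have hM1 : x / 2 ≤ M := Nat.le_ceil _
  have hM2 : (M : ℝ) < x / 2 + 1 := Nat.ceil_lt_add_one (by linarith)
  have h := arithmetic_large_sieve hP Ω hΩ h𝒬 (Real.sqrt_pos.mpr (by linarith)) hQI (M := M)
    (fun b hb => by
      have := hB b hb
      exact_mod_cast (show (b : ℝ) ≤ 2 * M by linarith)) hBΩ
  have h4 : Real.sqrt x ^ 4 = x ^ 2 := by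
    rw [show (4 : ℕ) = 2 * 2 from rfl, pow_mul, Real.sq_sqrt (by linarith)]
  rw [h4] at h
  have hM0 : (0 : ℝ) < M := by linarith
  refine le_of_mul_le_mul_left (h.trans ?_) hM0
  nlinarith

lemma sieveWeight_ge {p : ℕ} {Ω : Finset (ZMod p)} (hΩ : Ω.card < p) :
    (Ω.card : ℝ) / p ≤ sieveWeight p Ω := by
  have h1 : (Ω.card : ℝ) < p := by exact_mod_cast hΩ
  refine div_le_div_of_nonneg_left (by positivity) (by linarith) ?_
  linarith [(Nat.cast_nonneg Ω.card : (0 : ℝ) ≤ Ω.card)]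

lemma card_lt_prime_of_le {K : ℝ} (hK : 1000 ≤ K) {r p : ℕ} (hr : (r : ℝ) ≤ K)
    (hp : K ^ 3 ≤ p) : (r : ℝ) + 1 < p := by
  nlinarith [sq_nonneg K, mul_pos (show (0 : ℝ) < K by linarith) (show (0 : ℝ) < K by linarith)]

/-- The primes up to `N` in a given set. -/
noncomputable def primesUpTo (Pset : Set ℕ) (N : ℕ) : Finset ℕ :=
  by classical exact {p ∈ Finset.range (N + 1) | p.Prime ∧ p ∈ Pset}

lemma mem_primesUpTo {Pset : Set ℕ} {N p : ℕ} :
    p ∈ primesUpTo Pset N ↔ p ≤ N ∧ p.Prime ∧ p ∈ Pset := by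
  simp [primesUpTo]

lemma natCast_injOn_of_mem_sdiff {P A : Finset ℕ} {p : ℕ} (hp : p ∈ P \ differencePrimes P A) :
    ∀ a ∈ A, ∀ b ∈ A, (a : ZMod p) = (b : ZMod p) → a = b := by
  intro a ha b hb hab
  by_contra hne
  obtain ⟨hpP, hnd⟩ := Finset.mem_sdiff.mp hp
  exact hnd (Finset.mem_filter.mpr ⟨hpP, a, ha, b, hb, hne, hab⟩)

section SmallSummand

variable {x K : ℝ} {Pset : Set ℕ} {S S₀ A B : Finset ℕ}

lemma relDensity_pos (hS₀ : S₀.Nonempty) (hsub : S₀ ⊆ S) : 0 < relDensity S S₀ := by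
  have h1 : (0 : ℝ) < S₀.card := by exact_mod_cast hS₀.card_pos
  have h2 : (0 : ℝ) < S.card := by exact_mod_cast (hS₀.mono hsub).card_pos
  exact div_pos h1 h2

lemma relDensity_le_one (hsub : S₀ ⊆ S) : relDensity S S₀ ≤ 1 :=
  div_le_one_of_le₀ (by exact_mod_cast Finset.card_le_card hsub) (by positivity)

lemma relDensity_mul_card (hS₀ : S₀.Nonempty) (hsub : S₀ ⊆ S) :
    relDensity S S₀ * S.card = S₀.card := by
  have h2 : (0 : ℝ) < S.card := by exact_mod_cast (hS₀.mono hsub).card_pos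
  unfold relDensity
  field_simp

lemma relDensity_mul_density (hS₀ : S₀.Nonempty) (hsub : S₀ ⊆ S) :
    relDensity S S₀ * density x S = S₀.card / x := by
  rw [density, ← mul_div_assoc, relDensity_mul_card hS₀ hsub]

lemma card_le_of_forall_mem_le (hx : 0 ≤ x) (hS : ∀ s ∈ S, 1 ≤ s ∧ (s : ℝ) ≤ x) :
    (S.card : ℝ) ≤ x := by
  have h1 : S ⊆ Finset.Icc 1 ⌊x⌋₊ := fun s hs =>
    Finset.mem_Icc.mpr ⟨(hS s hs).1, Nat.le_floor (hS s hs).2⟩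
  have h2 := Finset.card_le_card h1
  rw [Nat.card_Icc, Nat.add_sub_cancel] at h2
  exact le_trans (by exact_mod_cast h2) (Nat.floor_le hx)

/-- If the sieve controls the size of `S`, the summand `A` has more than `K` elements. -/
lemma lt_card_of_sieveControlsSize (hx : 40 ≤ x) (hxlog : 1 ≤ Real.log x)
    (hK : 1000 * Real.log x ≤ K) (hPK : ∀ p ∈ Pset, K ^ 3 ≤ (p : ℝ))
    (hSP : ∀ s ∈ S, ∀ p ∈ Pset, ¬ p ∣ s) (hSx : ∀ s ∈ S, 1 ≤ s ∧ (s : ℝ) ≤ x)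
    (hS₀ : S₀.Nonempty) (hsub : S₀ ⊆ S) (hAB : ∀ a ∈ A, ∀ b ∈ B, a + b ∈ S₀)
    (hcard : S₀.card ≤ A.card * B.card) (hA : 2 ≤ A.card) (hBne : B.Nonempty)
    (h : SieveControlsSize x Pset S S₀) : K < A.card := by
  classical
  by_contra! hAK
  have hK1000 : 1000 ≤ K := by linarith
  have hAne : A.Nonempty := Finset.card_pos.mp (by omega)
  have hAx : ∀ a ∈ A, (a : ℝ) ≤ x := by
    intro a ha
    obtain ⟨b, hb⟩ := hBne
    exact le_trans (by exact_mod_cast Nat.le_add_right a b) (hSx _ (hsub (hAB a ha b hb))).2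
  have hBx : ∀ b ∈ B, (b : ℝ) ≤ x := by
    intro b hb
    obtain ⟨a, ha⟩ := hAne
    exact le_trans (by exact_mod_cast Nat.le_add_left b a) (hSx _ (hsub (hAB a ha b hb))).2
  have hsqrt : 1 ≤ Real.sqrt x := Real.one_le_sqrt.mpr (by linarith)
  set P := primesUpTo Pset ⌊Real.sqrt x⌋₊ with hPdef
  have hP : ∀ p ∈ P, p.Prime := fun p hp => (mem_primesUpTo.mp hp).2.1
  have hPS : ∀ p ∈ P, p ∈ Pset := fun p hp => (mem_primesUpTo.mp hp).2.2
  set τ := relDensity S S₀ * density x S with hτ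
  have hτeq : τ = S₀.card / x := relDensity_mul_density hS₀ hsub
  have hS₀pos : (0 : ℝ) < S₀.card := by exact_mod_cast hS₀.card_pos
  have hτpos : 0 < τ := by rw [hτeq]; exact div_pos hS₀pos (by linarith)
  have hτle : τ ≤ 1 := by
    rw [hτeq, div_le_one (by linarith)]
    exact le_trans (by exact_mod_cast Finset.card_le_card hsub)
      (card_le_of_forall_mem_le (by linarith) hSx)
  have hZ : 10 ≤ 10 * τ⁻¹ := by
    have := (one_le_inv₀ hτpos).mpr hτle
    linarith
  have hsum : 1 + 10 * τ⁻¹ ≤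
      ∑ I ∈ boundedSubsets P (Real.sqrt x), ∏ p ∈ I, (fun p : ℕ => (2 : ℝ) / p) p := by
    refine le_trans ((add_le_add_iff_left 1).mpr h) ?_
    refine one_add_sum_moebius_sq_le (Pset := Pset) (N := ⌊Real.sqrt x⌋₊) (w := fun p => 2 / (p : ℝ))
      (fun p hp hpS hpN => mem_primesUpTo.mpr ⟨hpN, hp, hpS⟩) hsqrt
      (Nat.floor_le (by linarith)) (fun p _ => by positivity) fun q hq => ?_
    rw [Finset.mem_filter, Finset.mem_Ioc] at hq
    exact ⟨hq.1.1, hq.1.2, hq.2⟩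
  set Ω : (p : ℕ) → Finset (ZMod p) := fun p => A.image fun a : ℕ => -(a : ZMod p) with hΩdef
  have hΩcard : ∀ p ∈ P \ differencePrimes P A, (Ω p).card = A.card := by
    intro p hp
    refine Finset.card_image_of_injOn fun a ha b hb hab => ?_
    exact natCast_injOn_of_mem_sdiff hp a ha b hb (neg_injective hab)
  have hlt : ∀ p ∈ P \ differencePrimes P A, (Ω p).card < p := by
    intro p hp
    have h1 := card_lt_prime_of_le hK1000 hAK (hPK p (hPS p (Finset.mem_sdiff.mp hp).1))
    rw [hΩcard p hp]
    exact_mod_cast (by linarith : (A.card : ℝ) < p)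
  have hlow := sieve_sum_lower_bound hP hK hxlog (fun p hp => hPK p (hPS p hp)) hAK hAx
    (w := fun p : ℕ => (2 : ℝ) / p) (g := fun p => sieveWeight p (Ω p))
    (fun p _ => by positivity) (fun p _ => le_rfl) hsqrt hZ (k := (A.card : ℝ) / 2)
    (by
      have : (2 : ℝ) ≤ A.card := by exact_mod_cast hA
      linarith) hsum (fun p hp => by
      have h1 := sieveWeight_ge (hlt p hp)
      rw [hΩcard p hp] at h1
      refine le_trans (le_of_eq ?_) h1
      ring)
  have hup := card_mul_sieve_sum_le (P := P \ differencePrimes P A)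
    (fun p hp => hP p (Finset.mem_sdiff.mp hp).1) Ω hlt
    (𝒬 := boundedSubsets (P \ differencePrimes P A) (Real.sqrt x))
    (fun I hI => (mem_boundedSubsets.mp hI).1) hx (fun I hI => (mem_boundedSubsets.mp hI).2) hBx
    (by
      intro b hb p hp hbΩ
      obtain ⟨a, ha, hab⟩ := Finset.mem_image.mp hbΩ
      refine hSP _ (hsub (hAB a ha b hb)) p (hPS p (Finset.mem_sdiff.mp hp).1) ?_
      rw [← ZMod.natCast_eq_zero_iff]
      push_cast
      rw [← hab]
      ring)
  have hfin := (mul_le_mul_of_nonneg_left hlow (Nat.cast_nonneg B.card)).trans hup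
  have hS₀x : (S₀.card : ℝ) = τ * x := by
    rw [hτeq]
    field_simp
  have hcard' : τ * x ≤ A.card * B.card := by
    rw [← hS₀x]
    exact_mod_cast hcard
  have h5 : (B.card : ℝ) * (98 / 100 * (A.card / 2 * (10 * τ⁻¹))) =
      49 / 10 * (A.card * B.card) * τ⁻¹ := by ring
  rw [h5, ← div_eq_mul_inv, div_le_iff₀ hτpos] at hfin
  nlinarith [mul_pos hτpos (show 0 < x by linarith)]

/-- If `S` satisfies the Bombieri–Vinogradov condition, the summand `A` has more than `K`
elements. -/
lemma lt_card_of_bombieriVinogradov (hxlog : 1 ≤ Real.log x)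
    (hK : 1000 * Real.log x ≤ K) (hPK : ∀ p ∈ Pset, K ^ 3 ≤ (p : ℝ))
    (hSP : ∀ s ∈ S, ∀ p ∈ Pset, ¬ p ∣ s) (hSx : ∀ s ∈ S, 1 ≤ s ∧ (s : ℝ) ≤ x)
    (hS₀ : S₀.Nonempty) (hsub : S₀ ⊆ S) (hAB : ∀ a ∈ A, ∀ b ∈ B, a + b ∈ S₀)
    (hcard : S₀.card ≤ A.card * B.card) (hA : 2 ≤ A.card) (hBne : B.Nonempty)
    (h : BombieriVinogradov K Pset S S₀) : K < A.card := by
  classical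
  by_contra! hAK
  obtain ⟨Q, hQ0, hmain, herr⟩ := h
  have hK1000 : 1000 ≤ K := by linarith
  obtain ⟨a₁, ha₁⟩ : A.Nonempty := Finset.card_pos.mp (by omega)
  have hAx : ∀ a ∈ A, (a : ℝ) ≤ x := by
    intro a ha
    obtain ⟨b, hb⟩ := hBne
    exact le_trans (by exact_mod_cast Nat.le_add_right a b) (hSx _ (hsub (hAB a ha b hb))).2
  have hQ1 : (1 : ℝ) ≤ Q := by exact_mod_cast hQ0
  set P := primesUpTo Pset Q with hPdef
  have hP : ∀ p ∈ P, p.Prime := fun p hp => (mem_primesUpTo.mp hp).2.1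
  have hPS : ∀ p ∈ P, p ∈ Pset := fun p hp => (mem_primesUpTo.mp hp).2.2
  set σ := relDensity S S₀ with hσ
  have hσpos : 0 < σ := relDensity_pos hS₀ hsub
  have hσle : σ ≤ 1 := relDensity_le_one hsub
  have hZ : 10 ≤ 10 * σ⁻¹ := by
    have := (one_le_inv₀ hσpos).mpr hσle
    linarith
  have hsum : 1 + 10 * σ⁻¹ ≤
      ∑ I ∈ boundedSubsets P (Q : ℝ), ∏ p ∈ I, (fun p : ℕ => (1 : ℝ) / p) p := by
    refine le_trans ((add_le_add_iff_left 1).mpr hmain) ?_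
    refine le_trans (le_of_eq ?_) (one_add_sum_moebius_sq_le (Pset := Pset) (N := Q)
      (s := {q ∈ Finset.Ioc 1 Q | PrimeDivisorsIn Pset q}) (w := fun p => 1 / (p : ℝ))
      (fun p hp hpS hpN => mem_primesUpTo.mpr ⟨hpN, hp, hpS⟩) hQ1 le_rfl
      (fun p _ => by positivity) fun q hq => ?_)
    · congr 1
      refine Finset.sum_congr (by congr!) fun q _ => ?_
      by_cases hq : Squarefree q
      · rw [Finset.prod_div_distrib, Finset.prod_const_one, ← Nat.cast_prod,
          Nat.prod_primeFactors_of_squarefree hq]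
        ring
      · rw [ArithmeticFunction.moebius_eq_zero_of_not_squarefree hq]
        simp
    · rw [Finset.mem_filter, Finset.mem_Ioc] at hq
      exact ⟨hq.1.1, hq.1.2, hq.2⟩
  set G := P \ differencePrimes P A with hG
  have hGP : ∀ p ∈ G, p ∈ P := fun p hp => (Finset.mem_sdiff.mp hp).1
  set Ω : (p : ℕ) → Finset (ZMod p) := fun p =>
    (A.erase a₁).image fun a : ℕ => (a₁ : ZMod p) - (a : ZMod p) with hΩdef
  set k : ℝ := (A.card : ℝ) - 1 with hk
  have hA' : (2 : ℝ) ≤ A.card := by exact_mod_cast hA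
  have hk1 : 1 ≤ k := by rw [hk]; linarith
  have hΩcard : ∀ p ∈ G, ((Ω p).card : ℝ) = k := by
    intro p hp
    rw [hΩdef, Finset.card_image_of_injOn, Finset.card_erase_of_mem ha₁,
      Nat.cast_sub (by omega), Nat.cast_one]
    intro a ha b hb hab
    exact natCast_injOn_of_mem_sdiff hp a (Finset.mem_of_mem_erase (Finset.mem_coe.mp ha)) b
      (Finset.mem_of_mem_erase (Finset.mem_coe.mp hb)) (sub_right_injective hab)
  have hΩ0 : ∀ p ∈ G, (0 : ZMod p) ∉ Ω p := by
    intro p hp h0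
    obtain ⟨a, ha, hab⟩ := Finset.mem_image.mp h0
    exact Finset.ne_of_mem_erase ha (natCast_injOn_of_mem_sdiff hp a₁ ha₁ a
      (Finset.mem_of_mem_erase ha) (sub_eq_zero.mp hab)).symm
  have hlt : ∀ p ∈ G, k + 2 < p := by
    intro p hp
    have h1 := card_lt_prime_of_le hK1000 hAK (hPK p (hPS p (hGP p hp)))
    rw [hk]
    linarith
  set g : ℕ → ℝ := fun p => k / ((p : ℝ) - 1 - k) with hgdef
  have hlow := sieve_sum_lower_bound hP hK hxlog (fun p hp => hPK p (hPS p hp)) hAK hAx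
    (w := fun p : ℕ => (1 : ℝ) / p) (g := g)
    (fun p _ => by positivity) (fun p _ => by gcongr; norm_num) hQ1 hZ hk1 hsum (fun p hp => by
      have h1 := hlt p hp
      rw [hgdef, mul_one_div]
      exact div_le_div_of_nonneg_left (by linarith) (by linarith) (by linarith))
  rw [← hG] at hlow
  set X : ℕ → Finset ℕ := fun s => {p ∈ G | (s : ZMod p) ∈ Ω p} with hX
  have hB'card : (B.image fun b => a₁ + b).card = B.card :=
    Finset.card_image_of_injective _ (add_right_injective a₁)
  have hsel := selberg_sieve (P := G) (𝒬 := boundedSubsets G Q)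
    (boundedSubsets_down fun p hp => hP p (hGP p hp))
    (fun I hI => (mem_boundedSubsets.mp hI).1) (h := fun p => k / ((p : ℝ) - 1)) (g := g)
    (fun p hp => by
      have h1 := hlt p hp
      have h2 : (p : ℝ) - 1 ≠ 0 := by linarith
      have h3 : (p : ℝ) - 1 - k ≠ 0 := by linarith
      simp only [hgdef]
      field_simp)
    (fun p hp => by
      have h1 := hlt p hp
      exact div_nonneg (by linarith) (by linarith))
    S (B.image fun b => a₁ + b)
    (Finset.image_subset_iff.mpr fun b hb => hsub (hAB a₁ ha₁ b hb)) X
    (by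
      intro s hs
      obtain ⟨b, hb, rfl⟩ := Finset.mem_image.mp hs
      refine Finset.disjoint_left.mpr fun p hp hpG => ?_
      obtain ⟨a, ha, hab⟩ := Finset.mem_image.mp (Finset.mem_filter.mp hp).2
      refine hSP _ (hsub (hAB a (Finset.mem_of_mem_erase ha) b hb)) p (hPS p (hGP p hpG)) ?_
      rw [← ZMod.natCast_eq_zero_iff]
      push_cast at hab ⊢
      linear_combination -hab)
    (R := fun D => k ^ D.card * maxDiscrepancy S (∏ p ∈ D, p))
    (by
      intro D hD
      have h1 := abs_card_filter_sub_le_maxDiscrepancy (D := D)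
        (fun p hp => hP p (hGP p (hD hp))) Ω (fun p hp => hΩ0 p (hD hp)) S
      rw [Finset.prod_congr rfl fun p hp => hΩcard p (hD hp), Finset.prod_const,
        Finset.prod_congr rfl fun p hp => by rw [hΩcard p (hD hp)]] at h1
      have h2 : {s ∈ S | D ⊆ X s} = {s ∈ S | ∀ p ∈ D, (s : ZMod p) ∈ Ω p} := by
        refine Finset.filter_congr fun s _ => ?_
        simp only [hX, Finset.subset_iff, Finset.mem_filter]
        exact ⟨fun h p hp => (h hp).2, fun h p hp => ⟨hD hp, h p hp⟩⟩
      rw [h2]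
      exact h1)
  rw [hB'card] at hsel
  have herr' := (sum_sum_error_le (P := G) (fun p hp => hP p (hGP p hp)) (Pset := Pset)
    (fun p hp => hPS p (hGP p hp)) (by linarith : 1 ≤ K) (by linarith : 0 ≤ k)
    (by rw [hk]; linarith) Q S (fun d hd1 hdQ hdP =>
      Finset.mem_filter.mpr ⟨Finset.mem_Icc.mpr ⟨hd1, hdQ⟩, hdP⟩)).trans herr
  set L := ∑ I ∈ boundedSubsets G (Q : ℝ), ∏ p ∈ I, g p with hL
  set E := ∑ D ∈ boundedSubsets G (Q : ℝ), ∑ E ∈ boundedSubsets G (Q : ℝ),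
    k ^ (D ∪ E).card * maxDiscrepancy S (∏ p ∈ D ∪ E, p) with hE
  have hS₀eq : σ * S.card = S₀.card := relDensity_mul_card hS₀ hsub
  have hS₀pos : (0 : ℝ) < S₀.card := by exact_mod_cast hS₀.card_pos
  have herr2 : E ≤ S₀.card / (2 * K) := by
    refine herr'.trans (le_of_eq ?_)
    rw [← hS₀eq]
    field_simp
  have hLpos : 0 < L := lt_of_lt_of_le (by positivity) hlow
  have hB1 : ((B.card : ℝ) - E) * L ≤ S.card := by linarith
  have hB2 : ((B.card : ℝ) - E) * (98 / 10 * k) ≤ S₀.card := by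
    rcases le_or_gt ((B.card : ℝ) - E) 0 with hneg | hpos
    · nlinarith
    · have h1 := (mul_le_mul_of_nonneg_left hlow hpos.le).trans hB1
      have h2 : ((B.card : ℝ) - E) * (98 / 100 * (k * (10 * σ⁻¹))) =
          ((B.card : ℝ) - E) * (98 / 10 * k) / σ := by
        field_simp
        ring
      rw [h2, div_le_iff₀ hσpos] at h1
      linarith
  have hcard' : (S₀.card : ℝ) ≤ A.card * B.card := by exact_mod_cast hcard
  have hr2k : (A.card : ℝ) ≤ 2 * k := by rw [hk]; linarith
  have hE2 : A.card * E ≤ S₀.card / 2 := by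
    calc (A.card : ℝ) * E ≤ A.card * (S₀.card / (2 * K)) :=
          mul_le_mul_of_nonneg_left herr2 (by positivity)
      _ ≤ K * (S₀.card / (2 * K)) := mul_le_mul_of_nonneg_right hAK (by positivity)
      _ = S₀.card / 2 := by
          field_simp
  have hB3 : A.card * ((B.card : ℝ) - E) ≤ 2 / 9 * S₀.card := by
    rcases le_or_gt ((B.card : ℝ) - E) 0 with hneg | hpos
    · nlinarith
    · nlinarith [mul_le_mul_of_nonneg_right hr2k hpos.le]
  nlinarith

end SmallSummand

/-- Chebyshev's lower bound for the primes in `(y / 8, y]`. -/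
lemma eventually_le_theta_sub_theta :
    ∀ᶠ y : ℝ in Filter.atTop, y / 4 ≤ Chebyshev.theta y - Chebyshev.theta (y / 8) := by
  have h1 := (isLittleO_log_rpow_atTop (show (0 : ℝ) < 1 / 2 by norm_num)).bound
    (show (0 : ℝ) < 1 / 100 by norm_num)
  filter_upwards [h1, Filter.eventually_ge_atTop (100 : ℝ)] with y hy hy100
  rw [← Real.sqrt_eq_rpow, Real.norm_of_nonneg (Real.log_nonneg (by linarith)),
    Real.norm_of_nonneg (Real.sqrt_nonneg _)] at hy
  have hge := Chebyshev.theta_ge' (x := y) (by linarith)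
  have hle := Chebyshev.theta_le_log4_mul_x (x := y / 8) (by linarith)
  have hlog4 : Real.log 4 = 2 * Real.log 2 := by
    rw [show (4 : ℝ) = 2 ^ 2 by norm_num, Real.log_pow]
    norm_num
  rw [hlog4] at hle
  have hs : Real.sqrt y * Real.sqrt y = y := Real.mul_self_sqrt (by linarith)
  have hs1 : 1 ≤ Real.sqrt y := Real.one_le_sqrt.mpr (by linarith)
  have hsl : 2 * Real.sqrt y * Real.log y ≤ y / 50 := by nlinarith
  have hl2 : Real.log (y + 2) ≤ y / 50 := by
    have : Real.log (y + 2) ≤ Real.log (y ^ 2) := Real.log_le_log (by linarith) (by nlinarith)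
    rw [Real.log_pow] at this
    push_cast at this
    nlinarith
  have := Real.log_two_gt_d9
  have := Real.log_two_lt_d9
  nlinarith

/-- The sum of `log p` over the primes `p ≤ y` in `P`. -/
noncomputable def logSum (P : Set ℕ) (y : ℝ) : ℝ := ∑ p ∈ primesUpTo P ⌊y⌋₊, Real.log p

lemma sum_log_sdiff_primesUpTo (P : Set ℕ) {y z : ℝ} (hzy : z ≤ y) :
    ∑ p ∈ primesUpTo P ⌊y⌋₊ \ primesUpTo P ⌊z⌋₊, Real.log p = logSum P y - logSum P z := by
  have hsub : primesUpTo P ⌊z⌋₊ ⊆ primesUpTo P ⌊y⌋₊ := by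
    intro p hp
    rw [mem_primesUpTo] at *
    exact ⟨hp.1.trans (Nat.floor_le_floor hzy), hp.2⟩
  rw [logSum, logSum, ← Finset.sum_sdiff hsub]
  ring

lemma dyadicLogSum_eq (P : Set ℕ) {y : ℝ} (hy : 0 ≤ y) :
    dyadicLogSum P y = logSum P y - logSum P (y / 2) := by
  rw [← sum_log_sdiff_primesUpTo P (by linarith), dyadicLogSum]
  refine Finset.sum_congr (Finset.ext fun p => ?_) fun _ _ => rfl
  simp only [Finset.mem_filter, Finset.mem_Ioc, Finset.mem_sdiff, mem_primesUpTo, not_and]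
  constructor
  · rintro ⟨⟨h1, h2⟩, h3, h4⟩
    exact ⟨⟨h2, h3, h4⟩, fun h => absurd h (by omega)⟩
  · rintro ⟨⟨h1, h2, h3⟩, h4⟩
    refine ⟨⟨?_, h1⟩, h2, h3⟩
    by_contra hcon
    exact h4 (by omega) h2 h3

lemma logSum_univ (y : ℝ) : logSum Set.univ y = Chebyshev.theta y := by
  rw [logSum, Chebyshev.theta]
  refine Finset.sum_congr (Finset.ext fun p => ?_) fun _ _ => rfl
  simp only [mem_primesUpTo, Finset.mem_filter, Finset.mem_Ioc, Set.mem_univ, and_true]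
  exact ⟨fun h => ⟨⟨h.2.pos, h.1⟩, h.2⟩, fun h => ⟨h.1.2, h.2⟩⟩

/-- The relative density hypothesis on dyadic blocks, on the block `(y / 8, y]`. -/
lemma mul_theta_sub_le_sum_log {P : Set ℕ} {c y : ℝ} (hy : 0 ≤ y)
    (h1 : c * dyadicLogSum Set.univ y ≤ dyadicLogSum P y)
    (h2 : c * dyadicLogSum Set.univ (y / 2) ≤ dyadicLogSum P (y / 2))
    (h3 : c * dyadicLogSum Set.univ (y / 4) ≤ dyadicLogSum P (y / 4)) :
    c * (Chebyshev.theta y - Chebyshev.theta (y / 8)) ≤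
      ∑ p ∈ primesUpTo P ⌊y⌋₊ \ primesUpTo P ⌊y / 8⌋₊, Real.log p := by
  rw [sum_log_sdiff_primesUpTo P (by linarith), ← logSum_univ, ← logSum_univ]
  rw [dyadicLogSum_eq _ hy, dyadicLogSum_eq _ hy] at h1
  rw [dyadicLogSum_eq _ (by linarith), dyadicLogSum_eq _ (by linarith),
    show y / 2 / 2 = y / 4 by ring] at h2
  rw [dyadicLogSum_eq _ (by linarith), dyadicLogSum_eq _ (by linarith),
    show y / 4 / 2 = y / 8 by ring] at h3
  linarith

/-- A lower bound for the density of residue classes occupied by `A`, on average over `T`. -/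
lemma le_sum_residueCount_div {T A : Finset ℕ} (hT : ∀ p ∈ T, p.Prime) (hA : A.Nonempty)
    {x y M m : ℝ} (hx : 1 < x) (hAx : ∀ a ∈ A, (a : ℝ) ≤ x) (hTy : ∀ p ∈ T, (p : ℝ) ≤ y)
    (hy : 1 < y) (hyx : Real.log y ≤ Real.log x / 4) (hM : 0 < M)
    (hMT : M ≤ ∑ p ∈ T, Real.log p) (hm : 0 < m) (hmA : m ≤ A.card)
    (hmM : m * Real.log x ≤ M) :
    2 * M * m / (y * Real.log x) ≤ ∑ p ∈ T, (residueCount A p : ℝ) / p := by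
  set Λ := ∑ p ∈ T, Real.log p with hΛ
  have hΛ0 : 0 < Λ := hM.trans_le hMT
  have hℓ : 0 < Real.log x := Real.log_pos hx
  have hlogy : 0 < Real.log y := Real.log_pos hy
  have hν : ∀ p, (0 : ℝ) < residueCount A p := fun p => by exact_mod_cast residueCount_pos hA p
  have hlog : ∀ p ∈ T, 0 ≤ Real.log p := fun p hp =>
    Real.log_nonneg (by exact_mod_cast (hT p hp).one_le)
  set V := ∑ p ∈ T, Real.log p * residueCount A p with hV
  have hW : ∑ p ∈ T, Real.log p / residueCount A p ≤ 2 * Λ / m := by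
    refine (larger_sieve hT hA hx.le hAx).trans ?_
    have h1 : Λ / A.card ≤ Λ / m := div_le_div_of_nonneg_left hΛ0.le hm hmA
    have h2 : Real.log x ≤ Λ / m := by
      rw [le_div_iff₀ hm]
      linarith
    calc _ ≤ Λ / m + Λ / m := add_le_add h1 h2
      _ = _ := by ring
  have hCS : Λ ^ 2 ≤ V * ∑ p ∈ T, Real.log p / residueCount A p := by
    refine Finset.sum_sq_le_sum_mul_sum_of_sq_le_mul T
      (fun p hp => mul_nonneg (hlog p hp) (hν p).le)
      (fun p hp => div_nonneg (hlog p hp) (hν p).le) fun p _ => le_of_eq ?_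
    have := (hν p).ne'
    field_simp
  have hV0 : 0 ≤ V := Finset.sum_nonneg fun p hp => mul_nonneg (hlog p hp) (hν p).le
  have hVge : M * m / 2 ≤ V := by
    have h1 := hCS.trans (mul_le_mul_of_nonneg_left hW hV0)
    rw [← mul_div_assoc, le_div_iff₀ hm] at h1
    have h2 : Λ * m ≤ 2 * V := by nlinarith
    nlinarith
  have hsum : V / (y * Real.log y) ≤ ∑ p ∈ T, (residueCount A p : ℝ) / p := by
    rw [hV, Finset.sum_div]
    refine Finset.sum_le_sum fun p hp => ?_
    have hp0 : (0 : ℝ) < p := by exact_mod_cast (hT p hp).pos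
    rw [div_le_div_iff₀ (by positivity) hp0]
    have h1 : Real.log p ≤ Real.log y := Real.log_le_log hp0 (hTy p hp)
    have h2 : Real.log p * p ≤ y * Real.log y := by
      rw [mul_comm]
      exact mul_le_mul (hTy p hp) h1 (hlog p hp) (by linarith)
    nlinarith [mul_le_mul_of_nonneg_left h2 (hν p).le]
  refine le_trans ?_ hsum
  rw [div_le_div_iff₀ (by positivity) (by positivity)]
  have h1 : y * Real.log y ≤ y * (Real.log x / 4) := mul_le_mul_of_nonneg_left hyx (by linarith)
  have h2 : 0 < y * Real.log x := by positivity
  nlinarith [mul_le_mul_of_nonneg_left h1 (show 0 ≤ 2 * M * m by positivity),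
    mul_le_mul_of_nonneg_right hVge h2.le]

/-- The large sieve with moduli `p q`, where `p ∈ T₁` and `q ∈ T₂`. -/
lemma card_mul_sum_mul_sum_le {T₁ T₂ A B : Finset ℕ} (hT₁ : ∀ p ∈ T₁, p.Prime)
    (hT₂ : ∀ p ∈ T₂, p.Prime) (hdisj : Disjoint T₁ T₂) {x : ℝ} (hx : 40 ≤ x)
    (hprod : ∀ p ∈ T₁, ∀ q ∈ T₂, (p : ℝ) * q ≤ Real.sqrt x) (hB : ∀ b ∈ B, (b : ℝ) ≤ x)
    (hAB : ∀ p ∈ T₁ ∪ T₂, ∀ a ∈ A, ∀ b ∈ B, ¬ p ∣ a + b) (hBne : B.Nonempty) :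
    B.card * ((∑ p ∈ T₁, (residueCount A p : ℝ) / p) * ∑ p ∈ T₂, (residueCount A p : ℝ) / p) ≤
      41 / 10 * x := by
  classical
  set P := T₁ ∪ T₂ with hPdef
  have hP : ∀ p ∈ P, p.Prime := fun p hp => (Finset.mem_union.mp hp).elim (hT₁ p) (hT₂ p)
  set Ω : (p : ℕ) → Finset (ZMod p) := fun p => A.image fun a : ℕ => -(a : ZMod p) with hΩ
  have hΩcard : ∀ p, (Ω p).card = residueCount A p := by
    intro p
    rw [residueCount, ← Finset.card_image_of_injective (A.image fun a : ℕ => (a : ZMod p))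
      (neg_injective (G := ZMod p)), Finset.image_image]
    rfl
  have hBΩ : ∀ b ∈ B, ∀ p ∈ P, (b : ZMod p) ∉ Ω p := by
    intro b hb p hp hbΩ
    obtain ⟨a, ha, hab⟩ := Finset.mem_image.mp hbΩ
    refine hAB p hp a ha b hb ?_
    rw [← ZMod.natCast_eq_zero_iff]
    push_cast
    rw [← hab]
    ring
  have hlt : ∀ p ∈ P, (Ω p).card < p := by
    intro p hp
    obtain ⟨b, hb⟩ := hBne
    have : NeZero p := ⟨(hP p hp).ne_zero⟩
    have h1 := Finset.card_lt_univ_of_notMem (hBΩ b hb p hp)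
    rwa [ZMod.card] at h1
  have hne : ∀ a ∈ T₁ ×ˢ T₂, a.1 ≠ a.2 := by
    intro a ha h
    obtain ⟨h1, h2⟩ := Finset.mem_product.mp ha
    exact Finset.disjoint_left.mp hdisj h1 (h ▸ h2)
  have hinj : Set.InjOn (fun a : ℕ × ℕ => ({a.1, a.2} : Finset ℕ)) (T₁ ×ˢ T₂ : Finset (ℕ × ℕ)) := by
    intro a ha b hb hab
    obtain ⟨ha1, ha2⟩ := Finset.mem_product.mp (Finset.mem_coe.mp ha)
    obtain ⟨hb1, hb2⟩ := Finset.mem_product.mp (Finset.mem_coe.mp hb)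
    have hd : ∀ p, p ∈ T₁ → p ∈ T₂ → False := fun p h1 h2 => Finset.disjoint_left.mp hdisj h1 h2
    have e1 := Finset.ext_iff.mp hab a.1
    have e2 := Finset.ext_iff.mp hab a.2
    simp only [Finset.mem_insert, Finset.mem_singleton, true_or, or_true, true_iff] at e1 e2
    refine Prod.ext (e1.resolve_right fun h => hd _ ha1 (h ▸ hb2))
      (e2.resolve_left fun h => hd _ (h ▸ hb1) ha2)
  have h := card_mul_sieve_sum_le hP Ω hlt
    (𝒬 := (T₁ ×ˢ T₂).image fun a : ℕ × ℕ => ({a.1, a.2} : Finset ℕ))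
    (by
      intro I hI
      obtain ⟨a, ha, rfl⟩ := Finset.mem_image.mp hI
      obtain ⟨h1, h2⟩ := Finset.mem_product.mp ha
      intro p hp
      simp only [Finset.mem_insert, Finset.mem_singleton] at hp
      rcases hp with rfl | rfl
      · exact Finset.mem_union_left _ h1
      · exact Finset.mem_union_right _ h2) hx
    (by
      intro I hI
      obtain ⟨a, ha, rfl⟩ := Finset.mem_image.mp hI
      obtain ⟨h1, h2⟩ := Finset.mem_product.mp ha
      rw [Finset.prod_pair (hne a ha)]
      push_cast
      exact hprod _ h1 _ h2) hB hBΩ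
  rw [Finset.sum_image hinj] at h
  refine le_trans (mul_le_mul_of_nonneg_left ?_ (by positivity)) h
  rw [Finset.sum_mul_sum, ← Finset.sum_product']
  refine Finset.sum_le_sum fun a ha => ?_
  obtain ⟨h1, h2⟩ := Finset.mem_product.mp ha
  rw [Finset.prod_pair (hne a ha)]
  have hw : ∀ p ∈ P, (residueCount A p : ℝ) / p ≤ sieveWeight p (Ω p) := by
    intro p hp
    rw [← hΩcard]
    exact sieveWeight_ge (hlt p hp)
  have hw1 := hw _ (Finset.mem_union_left _ h1)
  exact mul_le_mul hw1 (hw _ (Finset.mem_union_right _ h2)) (by positivity)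
    (le_trans (by positivity) hw1)

lemma eventually_large_parameters :
    ∀ᶠ x : ℝ in Filter.atTop, 40 ≤ x ∧ 1 ≤ Real.log x ∧ x ^ (1 / 10 : ℝ) * 32 ≤ x ^ (1 / 4 : ℝ) ∧
      8 < x ^ (1 / 4 : ℝ) ∧
      (∀ y : ℝ, x ^ (1 / 4 : ℝ) / 8 ≤ y →
        y / 4 ≤ Chebyshev.theta y - Chebyshev.theta (y / 8)) := by
  obtain ⟨y₀, hy₀⟩ := Filter.eventually_atTop.mp eventually_le_theta_sub_theta
  have h4 := tendsto_rpow_atTop (show (0 : ℝ) < 1 / 4 by norm_num)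
  have h20 := tendsto_rpow_atTop (show (0 : ℝ) < 3 / 20 by norm_num)
  filter_upwards [Filter.eventually_ge_atTop (40 : ℝ),
    Real.tendsto_log_atTop.eventually_ge_atTop 1, h20.eventually_ge_atTop 32,
    h4.eventually_gt_atTop 8, h4.eventually_ge_atTop (8 * y₀)] with x hx hlog h32 h8 hy
  refine ⟨hx, hlog, ?_, h8, fun y hyx => hy₀ y (by linarith)⟩
  have : x ^ (1 / 4 : ℝ) = x ^ (1 / 10 : ℝ) * x ^ (3 / 20 : ℝ) := by
    rw [← Real.rpow_add (by linarith)]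
    norm_num
  rw [this]
  gcongr

/-- If `A` has more than `K` elements, then `B` has at most about `√x` elements. -/
lemma card_le_of_lt_card {x c : ℝ} {P₀ : Set ℕ} {A B : Finset ℕ} (hx : 40 ≤ x)
    (hxlog : 1 ≤ Real.log x) (hx10 : x ^ (1 / 10 : ℝ) * 32 ≤ x ^ (1 / 4 : ℝ))
    (hx8 : 8 < x ^ (1 / 4 : ℝ))
    (hθ : ∀ y : ℝ, x ^ (1 / 4 : ℝ) / 8 ≤ y →
      y / 4 ≤ Chebyshev.theta y - Chebyshev.theta (y / 8))
    (hc : 0 < c)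
    (hdyadic : ∀ y : ℝ, x ^ (1 / 10 : ℝ) ≤ y → y ≤ x ^ (1 / 2 : ℝ) →
      c * dyadicLogSum Set.univ y ≤ dyadicLogSum P₀ y)
    (hA : A.Nonempty) (hBne : B.Nonempty) (hAx : ∀ a ∈ A, (a : ℝ) ≤ x)
    (hBx : ∀ b ∈ B, (b : ℝ) ≤ x) (hAB : ∀ p ∈ P₀, ∀ a ∈ A, ∀ b ∈ B, ¬ p ∣ a + b)
    {τ : ℝ} (hτ : 0 < τ) (hcard : τ * x ≤ A.card * B.card)
    (hK : 1000 * (τ * c ^ 2)⁻¹ * Real.log x ^ 2 < A.card) :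
    (B.card : ℝ) ≤ 20000 * (Real.sqrt x * Real.log x ^ 4 / c ^ 4) := by
  set ℓ := Real.log x with hℓ
  have hx0 : 0 < x := by linarith
  have hℓ0 : 0 < ℓ := by linarith
  set Y := x ^ (1 / 4 : ℝ) with hY
  have hYsq : Y ^ 2 = Real.sqrt x := by
    rw [hY, ← Real.rpow_natCast, ← Real.rpow_mul hx0.le, Real.sqrt_eq_rpow]
    norm_num
  have hlogY : Real.log Y = ℓ / 4 := by
    rw [hY, Real.log_rpow hx0]
    ring
  have hYhalf : Y ≤ x ^ (1 / 2 : ℝ) :=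
    Real.rpow_le_rpow_of_exponent_le (by linarith) (by norm_num)
  set T : ℝ → Finset ℕ := fun y => primesUpTo P₀ ⌊y⌋₊ \ primesUpTo P₀ ⌊y / 8⌋₊ with hT
  have hTp : ∀ y, ∀ p ∈ T y, p.Prime := fun y p hp =>
    (mem_primesUpTo.mp (Finset.mem_sdiff.mp hp).1).2.1
  have hTP : ∀ y, ∀ p ∈ T y, p ∈ P₀ := fun y p hp =>
    (mem_primesUpTo.mp (Finset.mem_sdiff.mp hp).1).2.2
  have hTle : ∀ y, 0 ≤ y → ∀ p ∈ T y, (p : ℝ) ≤ y := fun y hy p hp =>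
    (Nat.le_floor_iff hy).mp (mem_primesUpTo.mp (Finset.mem_sdiff.mp hp).1).1
  have hTsum : ∀ y, Y / 8 ≤ y → y ≤ Y → c * y / 4 ≤ ∑ p ∈ T y, Real.log p := by
    intro y h1 h2
    refine le_trans ?_ (mul_theta_sub_le_sum_log (P := P₀) (c := c) (by linarith)
      (hdyadic y (by linarith) (by linarith)) (hdyadic (y / 2) (by linarith) (by linarith))
      (hdyadic (y / 4) (by linarith) (by linarith)))
    have := mul_le_mul_of_nonneg_left (hθ y h1) hc.le
    linarith
  have hApos : (0 : ℝ) < A.card := by exact_mod_cast hA.card_pos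
  set m := min (A.card : ℝ) (c * (Y / 8) / (4 * ℓ)) with hm
  have hm0 : 0 < m := lt_min hApos (by positivity)
  have hU : ∀ y, Y / 8 ≤ y → y ≤ Y → c * m / (2 * ℓ) ≤ ∑ p ∈ T y, (residueCount A p : ℝ) / p := by
    intro y h1 h2
    have hy1 : 1 < y := by linarith
    refine le_trans (le_of_eq ?_) (le_sum_residueCount_div (hTp y) hA (by linarith : 1 < x) hAx
      (hTle y (by linarith)) hy1 (by
        rw [← hlogY]
        exact Real.log_le_log (by linarith) h2) (M := c * y / 4) (by positivity) (hTsum y h1 h2)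
      hm0 (min_le_left _ _) ?_)
    · rw [← hℓ]
      field_simp
      ring
    · rw [← hℓ]
      have h3 : m ≤ c * (Y / 8) / (4 * ℓ) := min_le_right _ _
      rw [le_div_iff₀ (by positivity)] at h3
      nlinarith [mul_le_mul_of_nonneg_left h1 hc.le]
  have hdisj : Disjoint (T Y) (T (Y / 8)) := by
    refine Finset.disjoint_left.mpr fun p h1 h2 => ?_
    exact (Finset.mem_sdiff.mp h1).2 (Finset.mem_sdiff.mp h2).1
  have hls := card_mul_sum_mul_sum_le (A := A) (hTp Y) (hTp (Y / 8)) hdisj hx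
    (fun p hp q hq => by
      have h1 := hTle Y (by linarith) p hp
      have h2 := hTle (Y / 8) (by linarith) q hq
      rw [← hYsq]
      have h3 : (0 : ℝ) ≤ p := by positivity
      have h4 : (0 : ℝ) ≤ q := by positivity
      nlinarith) hBx
    (fun p hp => hAB p ((Finset.mem_union.mp hp).elim (hTP Y p) (hTP (Y / 8) p))) hBne
  have hB0 : (0 : ℝ) ≤ B.card := by positivity
  have hmain : (B.card : ℝ) * (c * m / (2 * ℓ)) ^ 2 ≤ 41 / 10 * x := by
    refine le_trans (mul_le_mul_of_nonneg_left ?_ hB0) hls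
    have h1 := hU Y (by linarith) le_rfl
    rw [sq]
    exact mul_le_mul h1 (hU (Y / 8) le_rfl (by linarith)) (by positivity)
      (le_trans (by positivity) h1)
  rcases min_choice (A.card : ℝ) (c * (Y / 8) / (4 * ℓ)) with h | h
  · exfalso
    rw [hm, h, div_pow, ← mul_div_assoc, div_le_iff₀ (by positivity)] at hmain
    have h1 : τ * x * (c ^ 2 * A.card) ≤ A.card * B.card * (c ^ 2 * A.card) :=
      mul_le_mul_of_nonneg_right hcard (mul_nonneg (sq_nonneg c) hApos.le)
    have h2 : 1000 * ℓ ^ 2 < A.card * (τ * c ^ 2) := by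
      have h3 : 1000 * (τ * c ^ 2)⁻¹ * ℓ ^ 2 = 1000 * ℓ ^ 2 / (τ * c ^ 2) := by
        rw [div_eq_mul_inv]
        ring
      rwa [h3, div_lt_iff₀ (by positivity)] at hK
    have h4 := mul_lt_mul_of_pos_left h2 hx0
    have h5 : 0 < x * ℓ ^ 2 := by positivity
    nlinarith
  · rw [hm, h] at hmain
    have h1 : (c * (c * (Y / 8) / (4 * ℓ)) / (2 * ℓ)) ^ 2 =
        c ^ 4 * Real.sqrt x / (4096 * ℓ ^ 4) := by
      rw [← hYsq]
      field_simp
      norm_num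
    rw [h1, ← mul_div_assoc, div_le_iff₀ (by positivity)] at hmain
    have hs0 : 0 < Real.sqrt x := Real.sqrt_pos.mpr hx0
    have hss : Real.sqrt x * Real.sqrt x = x := Real.mul_self_sqrt hx0.le
    rw [← mul_div_assoc, le_div_iff₀ (by positivity)]
    refine le_of_mul_le_mul_right (a := Real.sqrt x) ?_ hs0
    calc (B.card : ℝ) * c ^ 4 * Real.sqrt x = B.card * (c ^ 4 * Real.sqrt x) := by ring
      _ ≤ 41 / 10 * x * (4096 * ℓ ^ 4) := hmain
      _ ≤ 20000 * x * ℓ ^ 4 := by nlinarith [show 0 < x * ℓ ^ 4 by positivity]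
      _ = 20000 * (Real.sqrt x * ℓ ^ 4) * Real.sqrt x := by
          linear_combination (-20000 * ℓ ^ 4) * hss

end AdditiveDecomposition

open AdditiveDecomposition
theorem mainTheorem1 :
    ∃ x₀ C₁ C₂ : ℝ, 0 < C₁ ∧ 0 < C₂ ∧
      ∀ (x c : ℝ) (P₀ : Set ℕ) (S S₀ : Finset ℕ),
        x₀ ≤ x →
        x ^ (-(1 / 10) : ℝ) < c → c ≤ 1 →
        (∀ p ∈ P₀, p.Prime) →
        (∀ y : ℝ, x ^ (1 / 10 : ℝ) ≤ y → y ≤ x ^ (1 / 2 : ℝ) →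
          c * dyadicLogSum Set.univ y ≤ dyadicLogSum P₀ y) →
        S.Nonempty →
        (∀ s ∈ S, 1 ≤ s ∧ (s : ℝ) ≤ x) →
        (∀ s ∈ S, ∀ p ∈ P₀, ¬ p ∣ s) →
        S₀.Nonempty → S₀ ⊆ S →
        (SieveControlsSize x (largePrimes P₀ (paramK x c S S₀)) S S₀ ∨
          BombieriVinogradov (paramK x c S S₀) (largePrimes P₀ (paramK x c S S₀)) S S₀) →
        ∀ A B : Set ℕ, (S₀ : Set ℕ) = A + B → 2 ≤ A.ncard → A.ncard ≤ B.ncard →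
          (B.ncard : ℝ) ≤ C₁ * (Real.sqrt x * Real.log x ^ 4 / c ^ 4) ∧
          C₂ * (Real.sqrt x * relDensity S S₀ * density x S * c ^ 4 / Real.log x ^ 4)
            ≤ (A.ncard : ℝ) := by
  classical
  obtain ⟨x₀, hx₀⟩ := Filter.eventually_atTop.mp eventually_large_parameters
  refine ⟨x₀, 20000, 1 / 20000, by norm_num, by norm_num, ?_⟩
  intro x c P₀ S S₀ hx hxc hc1 _ hdyadic _ hSx hSP hS₀ hsub hcond A' B' hsum hA2 hAB
  obtain ⟨hx40, hxlog, hx10, hx8, hθ⟩ := hx₀ x hx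
  have hx0 : 0 < x := by linarith
  have hc : 0 < c := (Real.rpow_pos_of_pos hx0 _).trans hxc
  obtain ⟨A, rfl⟩ := (Set.finite_of_ncard_ne_zero (by omega : A'.ncard ≠ 0)).exists_finset_coe
  obtain ⟨B, rfl⟩ := (Set.finite_of_ncard_ne_zero (by omega : B'.ncard ≠ 0)).exists_finset_coe
  rw [Set.ncard_coe_finset] at *
  rw [Set.ncard_coe_finset] at *
  have hS₀eq : S₀ = A + B := by exact_mod_cast hsum
  have hmem : ∀ a ∈ A, ∀ b ∈ B, a + b ∈ S₀ := fun a ha b hb => hS₀eq ▸ Finset.add_mem_add ha hb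
  have hcard : S₀.card ≤ A.card * B.card := hS₀eq ▸ Finset.card_add_le
  have hAne : A.Nonempty := Finset.card_pos.mp (by omega)
  have hBne : B.Nonempty := Finset.card_pos.mp (by omega)
  set τ := relDensity S S₀ * density x S with hτ
  have hτeq : τ = S₀.card / x := relDensity_mul_density hS₀ hsub
  have hS₀pos : (0 : ℝ) < S₀.card := by exact_mod_cast hS₀.card_pos
  have hτpos : 0 < τ := by rw [hτeq]; exact div_pos hS₀pos hx0
  have hτle : τ ≤ 1 := by
    rw [hτeq, div_le_one hx0]
    exact le_trans (by exact_mod_cast Finset.card_le_card hsub)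
      (card_le_of_forall_mem_le hx0.le hSx)
  set K := paramK x c S S₀ with hKdef
  have hKeq : K = 1000 * (τ * c ^ 2)⁻¹ * Real.log x ^ 2 := rfl
  have hK : 1000 * Real.log x ≤ K := by
    have h1 : τ * c ^ 2 ≤ 1 := mul_le_one₀ hτle (by positivity) (pow_le_one₀ hc.le hc1)
    have h2 : 1 ≤ (τ * c ^ 2)⁻¹ := (one_le_inv₀ (by positivity)).mpr h1
    rw [hKeq]
    nlinarith [mul_le_mul_of_nonneg_right h2 (sq_nonneg (Real.log x))]
  have hKA : K < A.card := by
    rcases hcond with h | h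
    · exact lt_card_of_sieveControlsSize hx40 hxlog hK (fun p hp => hp.2)
        (fun s hs p hp => hSP s hs p hp.1) hSx hS₀ hsub hmem hcard hA2 hBne h
    · exact lt_card_of_bombieriVinogradov hxlog hK (fun p hp => hp.2)
        (fun s hs p hp => hSP s hs p hp.1) hSx hS₀ hsub hmem hcard hA2 hBne h
  have hcard' : τ * x ≤ A.card * B.card := by
    rw [hτeq, div_mul_cancel₀ _ hx0.ne']
    exact_mod_cast hcard
  have hB := card_le_of_lt_card hx40 hxlog hx10 hx8 hθ hc hdyadic hAne hBne
    (fun a ha => by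
      obtain ⟨b, hb⟩ := hBne
      exact le_trans (by exact_mod_cast Nat.le_add_right a b) (hSx _ (hsub (hmem a ha b hb))).2)
    (fun b hb => by
      obtain ⟨a, ha⟩ := hAne
      exact le_trans (by exact_mod_cast Nat.le_add_left b a) (hSx _ (hsub (hmem a ha b hb))).2)
    (fun p hp a ha b hb => hSP _ (hsub (hmem a ha b hb)) p hp) hτpos hcard' (hKeq ▸ hKA)
  refine ⟨hB, ?_⟩
  have hs0 : 0 < Real.sqrt x := Real.sqrt_pos.mpr hx0
  have hss : Real.sqrt x * Real.sqrt x = x := Real.mul_self_sqrt hx0.le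
  have hℓ : 0 < Real.log x := by linarith
  have h1 := hcard'.trans (mul_le_mul_of_nonneg_left hB (by positivity))
  rw [← mul_div_assoc, ← mul_div_assoc, le_div_iff₀ (by positivity)] at h1
  have h4 : τ * Real.sqrt x * c ^ 4 * Real.sqrt x = τ * x * c ^ 4 := by
    linear_combination τ * c ^ 4 * hss
  have h2 : τ * Real.sqrt x * c ^ 4 ≤ 20000 * A.card * Real.log x ^ 4 :=
    le_of_mul_le_mul_right (by rw [h4]; linarith) hs0
  rw [← mul_div_assoc, div_le_iff₀ (by positivity)]
  have h3 : Real.sqrt x * relDensity S S₀ * density x S = τ * Real.sqrt x := by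
    rw [hτ]
    ring
  rw [h3]
  linarith
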